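/- Let $h:[0,1]\to\mathbb R$ be of bounded variation with $h(0)=0$, and suppose that $h$ is continuous on $[0,1]$ or strictly monotone (strictly increasing or strictly decreasing) on $[0,1]$. Let $\mathcal M_c$ be the set of compactly supported probability distributions on $\mathbb R$, identified with their cumulative distribution functions. Let $(\Omega,\mathcal F,\mathbb P)$ be a probability space on which every distribution in $\mathcal M_c$ is the law of some random variable, and let $\mathcal X_c$ be the set of (essentially) bounded random variables on it. For $F\in\mathcal M_c$ put $$I_h(F)=\int_0^\infty h(1-F(x))\,dx+\int_{-\infty}^0\bigl(h(1-F(x))-h(1)\bigr)\,dx ,$$ and for $X\in\mathcal X_c$ with distribution function $F_X$ put $I_h(X)=I_h(F_X)$. Then the following seven conditions are equivalent: (i) $h$ is convex on $[0,1]$; (ii) $I_h$ is concave-order monotone: $I_h(F)\le I_h(G)$ for all $F,G\in\mathcal M_c$ such that $\int f\,dF\le\int f\,dG$ for every concave $f:\mathbb R\to\mathbb R$; (iii) $I_h$ is o-superadditive: $I_h(X+Y)\ge I_h(X)+I_h(Y)$ for all $X,Y\in\mathcal X_c$; (iv) $I_h$ is o-concave: $I_h(\lambda X+(1-\lambda)Y)\ge\lambda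 I_h(X)+(1-\lambda)I_h(Y)$ for all $X,Y\in\mathcal X_c$ and $\lambda\in[0,1]$; (v) $I_h$ is o-quasi-concave: $I_h(\lambda X+(1-\lambda)Y)\ge\min\{I_h(X),I_h(Y)\}$ for all $X,Y\in\mathcal X_c$ and $\lambda\in[0,1]$; (vi) $I_h$ is m-convex: $I_h(\lambda F+(1-\lambda)G)\le\lambda I_h(F)+(1-\lambda)I_h(G)$ for all $F,G\in\mathcal M_c$ and $\lambda\in[0,1]$; (vii) $I_h$ is m-quasi-convex: $I_h(\lambda F+(1-\lambda)G)\le\max\{I_h(F),I_h(G)\}$ for all $F,G\in\mathcal M_c$ and $\lambda\in[0,1]$. -/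

import Mathlib

open MeasureTheory ProbabilityTheory Set

/-- Distortion functions: `h : [0,1] → ℝ` of bounded variation with `h 0 = 0`. The function is given
on all of `ℝ`, but only its values on `[0,1]` are ever used. -/
structure IsDistortion (h : ℝ → ℝ) : Prop where
  bv : BoundedVariationOn h (Icc 0 1)
  zero : h 0 = 0

/-- The compactly supported probability distributions on `ℝ`. -/
def compactLaws : Set (Measure ℝ) :=
  {μ | IsProbabilityMeasure μ ∧ ∃ K : Set ℝ, IsCompact K ∧ μ Kᶜ = 0}

/-- The mixture `t F + (1 - t) G` of two distributions. -/
noncomputable def mixture (t : ℝ) (μ ν : Measure ℝ) : Measure ℝ :=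
  ENNReal.ofReal t • μ + ENNReal.ofReal (1 - t) • ν

/-- The signed Choquet integral `I_h(F)`, where `F = cdf μ`. For a distortion function `h` and a
compactly supported `μ` both integrands are bounded, measurable and of bounded support. -/
noncomputable def signedChoquet (h : ℝ → ℝ) (μ : Measure ℝ) : ℝ :=
  (∫ x in Ioi (0 : ℝ), h (1 - cdf μ x)) + ∫ x in Iio (0 : ℝ), (h (1 - cdf μ x) - h 1)

/-- The bounded random variables on a probability space. -/
def boundedRV {Ω : Type*} [MeasurableSpace Ω] (P : Measure Ω) : Set (Ω → ℝ) :=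
  {X | Measurable X ∧ ∃ C : ℝ, ∀ᵐ ω ∂P, |X ω| ≤ C}

/-- The signed Choquet integral `I_h(X)` of a random variable: that of its distribution. -/
noncomputable def signedChoquetRV {Ω : Type*} [MeasurableSpace Ω] (P : Measure Ω)
    (h : ℝ → ℝ) (X : Ω → ℝ) : ℝ :=
  signedChoquet h (P.map X)

/-- Concave order `F ≤_cv G`. -/
def ConcaveOrder (μ ν : Measure ℝ) : Prop :=
  ∀ f : ℝ → ℝ, ConcaveOn ℝ univ f → ∫ x, f x ∂μ ≤ ∫ x, f x ∂ν

def ConcaveOrderMonotone (ρ : Measure ℝ → ℝ) : Prop :=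
  ∀ μ ∈ compactLaws, ∀ ν ∈ compactLaws, ConcaveOrder μ ν → ρ μ ≤ ρ ν

def MConvex (ρ : Measure ℝ → ℝ) : Prop :=
  ∀ μ ∈ compactLaws, ∀ ν ∈ compactLaws, ∀ t ∈ Icc (0 : ℝ) 1,
    ρ (mixture t μ ν) ≤ t * ρ μ + (1 - t) * ρ ν

def MQuasiConvex (ρ : Measure ℝ → ℝ) : Prop :=
  ∀ μ ∈ compactLaws, ∀ ν ∈ compactLaws, ∀ t ∈ Icc (0 : ℝ) 1,
    ρ (mixture t μ ν) ≤ max (ρ μ) (ρ ν)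

def OSuperadditive {Ω : Type*} [MeasurableSpace Ω] (P : Measure Ω) (ρ : (Ω → ℝ) → ℝ) : Prop :=
  ∀ X ∈ boundedRV P, ∀ Y ∈ boundedRV P, ρ X + ρ Y ≤ ρ (X + Y)

def OConcave {Ω : Type*} [MeasurableSpace Ω] (P : Measure Ω) (ρ : (Ω → ℝ) → ℝ) : Prop :=
  ∀ X ∈ boundedRV P, ∀ Y ∈ boundedRV P, ∀ t ∈ Icc (0 : ℝ) 1,
    t * ρ X + (1 - t) * ρ Y ≤ ρ (t • X + (1 - t) • Y)

def OQuasiConcave {Ω : Type*} [MeasurableSpace Ω] (P : Measure Ω) (ρ : (Ω → ℝ) → ℝ) : Prop :=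
  ∀ X ∈ boundedRV P, ∀ Y ∈ boundedRV P, ∀ t ∈ Icc (0 : ℝ) 1,
    min (ρ X) (ρ Y) ≤ ρ (t • X + (1 - t) • Y)

/-- The cumulative distribution function of a mixture is the mixture of the cumulative distribution
functions. -/
theorem cdf_mixture (μ ν : Measure ℝ) [IsProbabilityMeasure μ] [IsProbabilityMeasure ν]
    {t : ℝ} (ht : t ∈ Icc (0 : ℝ) 1) (x : ℝ) :
    cdf (mixture t μ ν) x = t * cdf μ x + (1 - t) * cdf ν x := by
  have h0 : 0 ≤ t := ht.1
  have h1 : 0 ≤ 1 - t := sub_nonneg.2 ht.2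
  have : IsProbabilityMeasure (mixture t μ ν) := ⟨by
    simp only [mixture, Measure.add_apply, Measure.smul_apply, measure_univ, smul_eq_mul, mul_one]
    rw [← ENNReal.ofReal_add h0 h1]
    simp⟩
  simp only [cdf_eq_real]
  rw [mixture, measureReal_add_apply
    (by simpa using ENNReal.mul_ne_top ENNReal.ofReal_ne_top (measure_ne_top μ _))
    (by simpa using ENNReal.mul_ne_top ENNReal.ofReal_ne_top (measure_ne_top ν _))]
  simp [ENNReal.toReal_ofReal, h0, h1]

/-- The signed Choquet integral of a random variable, in terms of the probabilities `P(X > x)`. -/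
theorem signedChoquetRV_eq {Ω : Type*} [MeasurableSpace Ω] (P : Measure Ω) [IsProbabilityMeasure P]
    (h : ℝ → ℝ) {X : Ω → ℝ} (hX : Measurable X) :
    signedChoquetRV P h X = (∫ x in Ioi (0 : ℝ), h (P.real {ω | x < X ω})) +
      ∫ x in Iio (0 : ℝ), (h (P.real {ω | x < X ω}) - h 1) := by
  have : IsProbabilityMeasure (P.map X) := Measure.isProbabilityMeasure_map hX.aemeasurable
  have key : ∀ x, 1 - cdf (P.map X) x = P.real {ω | x < X ω} := by
    intro x
    rw [cdf_eq_real, ← probReal_compl_eq_one_sub measurableSet_Iic, compl_Iic,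
      map_measureReal_apply hX measurableSet_Ioi]
    rfl
  simp only [signedChoquetRV, signedChoquet, key]

/-! Convexity is sufficient by reduction to upper tails. For `s ∈ [0,1]` the distortion `p ↦ min p
s` gives the minimum over `y` of `s * y + E (X - y)⁺`, which is subadditive in `X` and decreases
along the concave order; for `s = 1` it is the mean. A convex `h` is a pointwise limit of piecewise
linear interpolations, which are combinations of such distortions with nonpositive coefficients for
`s < 1`. The inequality therefore reverses, and equality of means absorbs the last coefficient, of
unknown sign (`add_signedChoquet_le_of_min`). This gives (ii) and (iii); positive homogeneity turns
(iii) into (iv). For (vi), survival functions are affine under mixing, so convexity of `h` is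
integrated pointwise.

Conversely, (ii) and (v), tested on laws with atoms in `{0, 1/2, 1}`, compare `h ((a + c) / 2)` with
`(h a + h c) / 2`; a bounded midpoint convex function is convex.

The hard converse starts from (vii), and only there does continuity or strict monotonicity enter.
Laws with two levels show that `(p, q) ↦ α h(p) + β h(q)` is midpoint quasi-convex on `p ≤ q`. If
midpoint convexity fails at `a, c`, balancing the weights forces increments of `h` on `[0, a]` and
on `[c, 1]` to grow geometrically, so boundedness leaves no positive increment towards a midpoint
(`midpoint_le_of_pair`). Strict monotonicity excludes this. A continuous `h` becomes constant on
both sides of arbitrarily short intervals `[a, c]`, so it jumps from `h 0` to `h 1` there, against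
uniform continuity; `h 0 = h 1` is excluded separately. -/

/-! ### Midpoint convexity and bounded functions -/

/-- A midpoint convex function that is bounded above is convex. -/
theorem convexOn_of_midpoint {s : Set ℝ} (hs : Convex ℝ s) {h : ℝ → ℝ}
    (hmid : ∀ x ∈ s, ∀ y ∈ s, 2 * h ((x + y) / 2) ≤ h x + h y)
    {C : ℝ} (hC : ∀ x ∈ s, h x ≤ C) : ConvexOn ℝ s h := by
  refine ⟨hs, fun x hx y hy a b ha hb hab => ?_⟩
  have hmem : ∀ t ∈ Icc (0 : ℝ) 1, (1 - t) * x + t * y ∈ s := fun t ht =>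
    hs hx hy (by linarith [ht.2]) ht.1 (by ring)
  -- The deviation from the chord vanishes at both ends. A midpoint with the nearer end as one
  -- endpoint gives `g t ≤ g (2 * t) / 2`, or its mirror image, so any upper bound for `g` can be
  -- halved indefinitely.
  set g : ℝ → ℝ := fun t => h ((1 - t) * x + t * y) - (1 - t) * h x - t * h y with hg
  have g0 : g 0 = 0 := by simp [hg]
  have g1 : g 1 = 0 := by simp [hg]
  have gmid : ∀ t ∈ Icc (0 : ℝ) 1, ∀ u ∈ Icc (0 : ℝ) 1, 2 * g ((t + u) / 2) ≤ g t + g u := by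
    intro t ht u hu
    have := hmid _ (hmem t ht) _ (hmem u hu)
    have e : ((1 - t) * x + t * y + ((1 - u) * x + u * y)) / 2
        = (1 - (t + u) / 2) * x + (t + u) / 2 * y := by ring
    rw [e] at this
    simp only [hg]
    linarith
  have gC : ∀ t ∈ Icc (0 : ℝ) 1, g t ≤ |C| + |h x| + |h y| := by
    intro t ht
    have h1 := hC _ (hmem t ht)
    have h2 : -((1 - t) * h x) ≤ |h x| := by
      nlinarith [neg_abs_le (h x), abs_nonneg (h x), ht.1, ht.2]
    have h3 : -(t * h y) ≤ |h y| := by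
      nlinarith [neg_abs_le (h y), abs_nonneg (h y), ht.1, ht.2]
    simp only [hg]
    linarith [le_abs_self C]
  have key : ∀ n : ℕ, ∀ t ∈ Icc (0 : ℝ) 1, g t ≤ (|C| + |h x| + |h y|) * (1 / 2) ^ n := by
    intro n
    induction n with
    | zero => simpa using gC
    | succ n ih =>
      intro t ht
      rw [pow_succ]
      rcases le_total t (1 / 2) with h2 | h2
      · have m : 2 * t ∈ Icc (0 : ℝ) 1 := ⟨by linarith [ht.1], by linarith⟩
        have := gmid 0 (by simp) _ m
        rw [g0, show (0 + 2 * t) / 2 = t by ring] at this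
        linarith [ih _ m]
      · have m : 2 * t - 1 ∈ Icc (0 : ℝ) 1 := ⟨by linarith, by linarith [ht.2]⟩
        have := gmid 1 (by simp) _ m
        rw [g1, show (1 + (2 * t - 1)) / 2 = t by ring] at this
        linarith [ih _ m]
  have hlim : Filter.Tendsto (fun n : ℕ => (|C| + |h x| + |h y|) * (1 / 2 : ℝ) ^ n)
      Filter.atTop (nhds ((|C| + |h x| + |h y|) * 0)) :=
    (tendsto_pow_atTop_nhds_zero_of_lt_one (by norm_num) (by norm_num)).const_mul _
  have : g b ≤ 0 := by
    simpa using ge_of_tendsto' hlim fun n => key n b ⟨hb, by linarith⟩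
  have ea : a = 1 - b := by linarith
  simp only [hg] at this
  simp only [smul_eq_mul, ea]
  linarith

/-! ### Midpoint quasi-convexity of separable sums -/

/-- If increments over adjacent intervals of equal length grow at least by a factor `K > 1`, and `h`
is bounded, then no increment is positive. -/
theorem midpoint_le_of_ratio {J : Set ℝ} (hJ : Convex ℝ J) {h : ℝ → ℝ} {B : ℝ}
    (hB : ∀ x ∈ J, |h x| ≤ B) {K : ℝ} (hK : 1 < K)
    (hE : ∀ x ∈ J, ∀ z ∈ J, K * (h ((x + z) / 2) - h x) ≤ h z - h ((x + z) / 2)) :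
    ∀ x ∈ J, ∀ z ∈ J, h ((x + z) / 2) ≤ h x := by
  have hm : ∀ x ∈ J, ∀ z ∈ J, (x + z) / 2 ∈ J := fun x hx z hz => by
    have := hJ hx hz (a := 1 / 2) (b := 1 / 2) (by norm_num) (by norm_num) (by norm_num)
    convert this using 1
    simp only [smul_eq_mul]
    ring
  -- Successive increments over the four quarters satisfy `d₂ ≥ L d₁`, `d₃ ≥ L d₂`, `d₄ ≥ L d₃`.
  -- Hence `d₃ + d₄ ≥ L² (d₁ + d₂)`: each bisection squares the ratio.
  have key : ∀ n : ℕ, ∀ x ∈ J, ∀ z ∈ J,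
      K ^ 2 ^ n * (h ((x + z) / 2) - h x) ≤ h z - h ((x + z) / 2) := by
    intro n
    induction n with
    | zero => simpa using hE
    | succ n ih =>
      intro x hx z hz
      have hL : 0 < K ^ 2 ^ n := by positivity
      rw [pow_succ, pow_mul, sq]
      set L := K ^ 2 ^ n
      have mm := hm x hx z hz
      have m1 := hm x hx _ mm
      have m3 := hm _ mm z hz
      have e1 := ih x hx _ mm
      have e2 := ih _ m1 _ m3
      have e3 := ih _ mm z hz
      rw [show ((x + (x + z) / 2) / 2 + ((x + z) / 2 + z) / 2) / 2 = (x + z) / 2 by ring] at e2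
      set v1 := h ((x + (x + z) / 2) / 2)
      set v2 := h ((x + z) / 2)
      set v3 := h (((x + z) / 2 + z) / 2)
      have f1 := mul_le_mul_of_nonneg_left e1 hL.le
      have f2 := mul_le_mul_of_nonneg_left e2 hL.le
      nlinarith
  intro x hx z hz
  by_contra! hlt
  obtain ⟨n, hn⟩ := pow_unbounded_of_one_lt (2 * B / (h ((x + z) / 2) - h x)) hK
  rw [div_lt_iff₀ (by linarith)] at hn
  have h1 : K ^ n ≤ K ^ 2 ^ n := pow_le_pow_right₀ hK.le (Nat.lt_two_pow_self).le
  have h2 := key n x hx z hz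
  have h3 := mul_le_mul_of_nonneg_right h1 (sub_pos.2 hlt).le
  have h4 := abs_le.1 (hB z hz)
  have h5 := abs_le.1 (hB _ (hm x hx z hz))
  linarith

/-- If `h` is not midpoint convex on `[a, c]`, then quasi-convexity of
`(p, q) ↦ α h(p) + β h(q)` forces `h` to be at most its boundary values at each midpoint. -/
theorem midpoint_le_of_pair {J : Set ℝ} (hJ : Convex ℝ J) {h : ℝ → ℝ} {B : ℝ}
    (hB : ∀ x ∈ J, |h x| ≤ B) {a c : ℝ} (hD : h a + h c < 2 * h ((a + c) / 2))
    (hpair : ∀ x ∈ J, ∀ z ∈ J, ∀ α β : ℝ, 0 ≤ α → 0 ≤ β →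
      α * h ((a + c) / 2) + β * h ((x + z) / 2) ≤ max (α * h a + β * h x) (α * h c + β * h z)) :
    ∀ x ∈ J, ∀ z ∈ J, h ((x + z) / 2) ≤ h x := by
  intro x₀ hx₀
  have hΔ : 0 < |h c - h a| := by
    rw [abs_pos]
    intro h0
    have := hpair x₀ hx₀ x₀ hx₀ 1 0 (by norm_num) le_rfl
    have e : h c = h a := by linarith
    rw [e] at this hD
    simp only [one_mul, zero_mul, add_zero, max_self] at this
    linarith
  -- The weights `|h z - h x|` and `|h c - h a|` make both arguments of the maximum equal when the
  -- two increments have opposite signs, so the maximum becomes an average. For equal signs, `x` and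
  -- `z` are exchanged.
  have hineq : ∀ x ∈ J, ∀ z ∈ J, (2 * h ((a + c) / 2) - h a - h c) * |h z - h x|
      ≤ |h c - h a| * (h x + h z - 2 * h ((x + z) / 2)) := by
    intro x hx z hz
    rcases lt_trichotomy ((h c - h a) * (h z - h x)) 0 with hs | hs | hs
    · have h1 := hpair x hx z hz |h z - h x| |h c - h a| (abs_nonneg _) (abs_nonneg _)
      rcases mul_neg_iff.1 hs with ⟨p, q⟩ | ⟨p, q⟩
      · rw [abs_of_pos p, abs_of_neg q] at *
        rw [max_eq_left (by linarith)] at h1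
        linarith
      · rw [abs_of_neg p, abs_of_pos q] at *
        rw [max_eq_left (by linarith)] at h1
        linarith
    · have hzx : h z - h x = 0 := by
        rcases mul_eq_zero.1 hs with h1 | h1
        · simp [h1] at hΔ
        · exact h1
      have h1 := hpair x hx z hz 0 1 le_rfl (by norm_num)
      have e : h z = h x := by linarith
      simp only [one_mul, zero_mul, zero_add, e, max_self] at h1
      rw [e, sub_self, abs_zero, mul_zero]
      exact mul_nonneg hΔ.le (by linarith)
    · have h1 := hpair z hz x hx |h z - h x| |h c - h a| (abs_nonneg _) (abs_nonneg _)
      rw [add_comm z x] at h1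
      rcases mul_pos_iff.1 hs with ⟨p, q⟩ | ⟨p, q⟩
      · rw [abs_of_pos p, abs_of_pos q] at *
        rw [max_eq_left (by linarith)] at h1
        linarith
      · rw [abs_of_neg p, abs_of_neg q] at *
        rw [max_eq_left (by linarith)] at h1
        linarith
  -- With `u`, `v` the increments over the two halves, `r * (u + v) ≤ v - u` reads `(1 + r) * u ≤ (1
  -- - r) * v`, whence the ratio `K` below. The cap `1 / 2` keeps `1 - r` positive.
  set r := min ((2 * h ((a + c) / 2) - h a - h c) / |h c - h a|) (1 / 2) with hr
  have r0 : 0 < r := lt_min (div_pos (by linarith) hΔ) (by norm_num)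
  have r1 : r ≤ 1 / 2 := min_le_right _ _
  have hr2 : ∀ x ∈ J, ∀ z ∈ J, r * |h z - h x| ≤ h x + h z - 2 * h ((x + z) / 2) := by
    intro x hx z hz
    calc r * |h z - h x| ≤ (2 * h ((a + c) / 2) - h a - h c) / |h c - h a| * |h z - h x| :=
          mul_le_mul_of_nonneg_right (min_le_left _ _) (abs_nonneg _)
      _ = (2 * h ((a + c) / 2) - h a - h c) * |h z - h x| / |h c - h a| := by ring
      _ ≤ _ := by
          rw [div_le_iff₀ hΔ, mul_comm _ |h c - h a|]
          exact hineq x hx z hz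
  refine midpoint_le_of_ratio hJ hB (K := (1 + r) / (1 - r)) ?_ ?_ x₀ hx₀
  · rw [lt_div_iff₀ (by linarith)]
    linarith
  · intro x hx z hz
    rw [div_mul_eq_mul_div, div_le_iff₀ (by linarith)]
    have h1 := hr2 x hx z hz
    have h2 := mul_le_mul_of_nonneg_left (le_abs_self (h z - h x)) r0.le
    linarith

/-- Repeated halving of the distance from `x` to `z` never raises the value above `h x`; continuity
at `z` gives `h z ≤ h x`, and the roles are symmetric. -/
theorem eq_of_midpoint_le {u v : ℝ} {h : ℝ → ℝ} (hc : ContinuousOn h (Icc u v))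
    (hm : ∀ x ∈ Icc u v, ∀ z ∈ Icc u v, h ((x + z) / 2) ≤ h x) :
    ∀ x ∈ Icc u v, ∀ z ∈ Icc u v, h z = h x := by
  have key : ∀ x ∈ Icc u v, ∀ z ∈ Icc u v, h z ≤ h x := by
    intro x hx z hz
    have hmem : ∀ n : ℕ, z + (x - z) * (1 / 2) ^ n ∈ Icc u v := by
      intro n
      have h0 : (0 : ℝ) ≤ (1 / 2) ^ n := by positivity
      have h1 : (1 / 2 : ℝ) ^ n ≤ 1 := pow_le_one₀ (by norm_num) (by norm_num)
      have := convex_Icc u v hz hx (sub_nonneg.2 h1) h0 (by ring)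
      convert this using 1
      simp only [smul_eq_mul]
      ring
    have hle : ∀ n : ℕ, h (z + (x - z) * (1 / 2) ^ n) ≤ h x := by
      intro n
      induction n with
      | zero => simp
      | succ n ih =>
        refine le_trans ?_ ih
        have e : (z + (x - z) * (1 / 2) ^ n + z) / 2 = z + (x - z) * (1 / 2) ^ (n + 1) := by ring
        rw [← e]
        exact hm _ (hmem n) z hz
    have hlim : Filter.Tendsto (fun n : ℕ => z + (x - z) * (1 / 2 : ℝ) ^ n)
        Filter.atTop (nhdsWithin z (Icc u v)) := by
      refine tendsto_nhdsWithin_iff.2 ⟨?_, Filter.Eventually.of_forall hmem⟩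
      have := ((tendsto_pow_atTop_nhds_zero_of_lt_one (r := (1 / 2 : ℝ)) (by norm_num)
        (by norm_num)).const_mul (x - z)).const_add z
      simpa using this
    exact le_of_tendsto' ((hc z hz).tendsto.comp hlim) hle
  exact fun x hx z hz => le_antisymm (key x hx z hz) (key z hz x hx)

/-- A failure of midpoint convexity occurs on arbitrarily short intervals. -/
theorem exists_short_not_midpoint {h : ℝ → ℝ} {a₀ c₀ : ℝ} (h₀ : a₀ ≤ c₀)
    (hI : Icc a₀ c₀ ⊆ Icc 0 1) (hD : h a₀ + h c₀ < 2 * h ((a₀ + c₀) / 2)) (n : ℕ) :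
    ∃ a c : ℝ, a ≤ c ∧ Icc a c ⊆ Icc 0 1 ∧ c - a ≤ (1 / 2) ^ n ∧
      h a + h c < 2 * h ((a + c) / 2) := by
  induction n with
  | zero =>
    refine ⟨a₀, c₀, h₀, hI, ?_, hD⟩
    have h1 := (hI (left_mem_Icc.2 h₀)).1
    have h2 := (hI (right_mem_Icc.2 h₀)).2
    simp only [pow_zero]
    linarith
  | succ n ih =>
    obtain ⟨a, c, hac, hsub, hlen, hD⟩ := ih
    -- If midpoint convexity held on the left, middle and right subintervals of half length, the sum
    -- of the outer inequalities and twice the middle one would give it on `[a, c]`.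
    by_contra! hcon
    rw [pow_succ] at hcon
    have s1 : Icc a ((a + c) / 2) ⊆ Icc 0 1 :=
      (Icc_subset_Icc le_rfl (by linarith)).trans hsub
    have s2 : Icc ((3 * a + c) / 4) ((a + 3 * c) / 4) ⊆ Icc 0 1 :=
      (Icc_subset_Icc (by linarith) (by linarith)).trans hsub
    have s3 : Icc ((a + c) / 2) c ⊆ Icc 0 1 :=
      (Icc_subset_Icc (by linarith) le_rfl).trans hsub
    have h1 := hcon _ _ (by linarith) s1 (by linarith)
    have h2 := hcon _ _ (by linarith) s2 (by linarith)
    have h3 := hcon _ _ (by linarith) s3 (by linarith)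
    rw [show (a + (a + c) / 2) / 2 = (3 * a + c) / 4 by ring] at h1
    rw [show ((3 * a + c) / 4 + (a + 3 * c) / 4) / 2 = (a + c) / 2 by ring] at h2
    rw [show ((a + c) / 2 + c) / 2 = (a + 3 * c) / 4 by ring] at h3
    linarith

/-- Quasi-convexity of all `(p, q) ↦ α h(p) + β h(q)` on ordered pairs of levels implies midpoint
convexity when `h` is continuous or strictly monotone. -/
theorem midpoint_convex_of_quasiconvex {h : ℝ → ℝ} {B : ℝ} (hB : ∀ x ∈ Icc (0 : ℝ) 1, |h x| ≤ B)
    (hcase : ContinuousOn h (Icc 0 1) ∨ StrictMonoOn h (Icc 0 1) ∨ StrictAntiOn h (Icc 0 1))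
    (hq : ∀ m ∈ Icc (0 : ℝ) 1, ∀ a ∈ Icc 0 m, ∀ c ∈ Icc 0 m, ∀ a' ∈ Icc m 1, ∀ c' ∈ Icc m 1,
      ∀ α β : ℝ, 0 ≤ α → 0 ≤ β → α * h ((a + c) / 2) + β * h ((a' + c') / 2)
        ≤ max (α * h a + β * h a') (α * h c + β * h c')) :
    ∀ x ∈ Icc (0 : ℝ) 1, ∀ y ∈ Icc (0 : ℝ) 1, 2 * h ((x + y) / 2) ≤ h x + h y := by
  by_contra! hcon
  obtain ⟨a₀, c₀, h₀, hI, hD₀⟩ : ∃ a₀ c₀ : ℝ, a₀ ≤ c₀ ∧ Icc a₀ c₀ ⊆ Icc 0 1 ∧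
      h a₀ + h c₀ < 2 * h ((a₀ + c₀) / 2) := by
    obtain ⟨x, hx, y, hy, hxy⟩ := hcon
    rcases le_total x y with hle | hle
    · exact ⟨x, y, hle, Icc_subset_Icc hx.1 hy.2, hxy⟩
    · exact ⟨y, x, hle, Icc_subset_Icc hy.1 hx.2, by rw [add_comm y x]; linarith⟩
  have hleft : ∀ a c : ℝ, a ≤ c → Icc a c ⊆ Icc 0 1 → h a + h c < 2 * h ((a + c) / 2) →
      ∀ x ∈ Icc 0 a, ∀ z ∈ Icc 0 a, h ((x + z) / 2) ≤ h x := by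
    intro a c hac hsub hD
    have ha := hsub (left_mem_Icc.2 hac)
    have hc := hsub (right_mem_Icc.2 hac)
    refine midpoint_le_of_pair (convex_Icc 0 a) (fun x hx => hB x ⟨hx.1, hx.2.trans ha.2⟩) hD ?_
    intro x hx z hz α β hα hβ
    have := hq a ha x hx z hz a ⟨le_rfl, ha.2⟩ c ⟨hac, hc.2⟩ β α hβ hα
    simpa only [add_comm] using this
  have hright : ∀ a c : ℝ, a ≤ c → Icc a c ⊆ Icc 0 1 → h a + h c < 2 * h ((a + c) / 2) →
      ∀ x ∈ Icc c 1, ∀ z ∈ Icc c 1, h ((x + z) / 2) ≤ h x := by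
    intro a c hac hsub hD
    have ha := hsub (left_mem_Icc.2 hac)
    have hc := hsub (right_mem_Icc.2 hac)
    refine midpoint_le_of_pair (convex_Icc c 1) (fun x hx => hB x ⟨hc.1.trans hx.1, hx.2⟩) hD ?_
    intro x hx z hz α β hα hβ
    exact hq c hc a ⟨ha.1, hac⟩ c ⟨hc.1, le_rfl⟩ x hx z hz α β hα hβ
  have hstrict : ¬ ∀ u v : ℝ, u < v → Icc u v ⊆ Icc 0 1 →
      ∃ x ∈ Icc u v, ∃ z ∈ Icc u v, h x < h ((x + z) / 2) := by
    intro hno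
    -- Length at most `1 / 2` ensures that `[0, a]` or `[c, 1]` is nondegenerate.
    obtain ⟨a, c, hac, hsub, hlen, hD⟩ := exists_short_not_midpoint h₀ hI hD₀ 1
    have ha := hsub (left_mem_Icc.2 hac)
    have hc := hsub (right_mem_Icc.2 hac)
    rcases lt_or_ge 0 a with h0 | h0
    · obtain ⟨x, hx, z, hz, hlt⟩ := hno 0 a h0 (Icc_subset_Icc le_rfl ha.2)
      exact absurd (hleft a c hac hsub hD x hx z hz) hlt.not_ge
    · obtain ⟨x, hx, z, hz, hlt⟩ := hno c 1 (by norm_num at hlen; linarith)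
        (Icc_subset_Icc hc.1 le_rfl)
      exact absurd (hright a c hac hsub hD x hx z hz) hlt.not_ge
  rcases hcase with hcont | hmono | hanti
  -- Otherwise constancy on both sides gives `h a₀ = h c₀`, and quasi-convexity with weights `1, 0`
  -- excludes a failure with equal end values.
  · have hne : h 1 ≠ h 0 := by
      intro he
      have hq0 : ∀ a c : ℝ, a ≤ c → Icc a c ⊆ Icc 0 1 → h a + h c < 2 * h ((a + c) / 2) →
          h a ≠ h c := by
        intro a c hac hsub hD hE
        have ha := hsub (left_mem_Icc.2 hac)
        have hc := hsub (right_mem_Icc.2 hac)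
        have := hq c hc a ⟨ha.1, hac⟩ c ⟨hc.1, le_rfl⟩ 1 ⟨hc.2, le_rfl⟩ 1 ⟨hc.2, le_rfl⟩ 1 0
          (by norm_num) le_rfl
        simp only [one_mul, zero_mul, add_zero, hE, max_self] at this
        linarith
      have ha := hI (left_mem_Icc.2 h₀)
      have hc := hI (right_mem_Icc.2 h₀)
      refine hq0 a₀ c₀ h₀ hI hD₀ ?_
      rw [eq_of_midpoint_le (hcont.mono (Icc_subset_Icc le_rfl ha.2)) (hleft a₀ c₀ h₀ hI hD₀)
          0 ⟨le_rfl, ha.1⟩ a₀ ⟨ha.1, le_rfl⟩,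
        eq_of_midpoint_le (hcont.mono (Icc_subset_Icc hc.1 le_rfl)) (hright a₀ c₀ h₀ hI hD₀)
          1 ⟨hc.2, le_rfl⟩ c₀ ⟨le_rfl, hc.2⟩, he]
    have huc := isCompact_Icc.uniformContinuousOn_of_continuous hcont
    rw [Metric.uniformContinuousOn_iff] at huc
    obtain ⟨δ, hδ, hδ'⟩ := huc |h 1 - h 0| (abs_pos.2 (sub_ne_zero.2 hne))
    obtain ⟨n, hn⟩ := exists_pow_lt_of_lt_one hδ (show (1 / 2 : ℝ) < 1 by norm_num)
    obtain ⟨a, c, hac, hsub, hlen, hD⟩ := exists_short_not_midpoint h₀ hI hD₀ n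
    have ha := hsub (left_mem_Icc.2 hac)
    have hc := hsub (right_mem_Icc.2 hac)
    have h1 := hδ' c hc a ha (by rw [Real.dist_eq, abs_of_nonneg (by linarith)]; linarith)
    rw [eq_of_midpoint_le (hcont.mono (Icc_subset_Icc le_rfl ha.2)) (hleft a c hac hsub hD)
          0 ⟨le_rfl, ha.1⟩ a ⟨ha.1, le_rfl⟩,
        eq_of_midpoint_le (hcont.mono (Icc_subset_Icc hc.1 le_rfl)) (hright a c hac hsub hD)
          1 ⟨hc.2, le_rfl⟩ c ⟨le_rfl, hc.2⟩, Real.dist_eq] at h1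
    exact lt_irrefl _ h1
  · refine hstrict fun u v huv hsub => ⟨u, left_mem_Icc.2 huv.le, v, right_mem_Icc.2 huv.le, ?_⟩
    exact hmono (hsub (left_mem_Icc.2 huv.le)) (hsub ⟨by linarith, by linarith⟩) (by linarith)
  · refine hstrict fun u v huv hsub => ⟨v, right_mem_Icc.2 huv.le, u, left_mem_Icc.2 huv.le, ?_⟩
    exact hanti (hsub ⟨by linarith, by linarith⟩) (hsub (right_mem_Icc.2 huv.le)) (by linarith)

/-! ### Laws on a bounded interval and their Choquet integrals -/

/-- The law `μ` is carried by `[-M, M]`. -/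
def CarriedBy (μ : Measure ℝ) (M : ℝ) : Prop := μ (Icc (-M) M)ᶜ = 0

namespace CarriedBy

variable {μ : Measure ℝ} {M N : ℝ}

theorem mono (h : CarriedBy μ M) (hMN : M ≤ N) : CarriedBy μ N :=
  measure_mono_null (compl_subset_compl.2 (Icc_subset_Icc (by linarith) hMN)) h

theorem cdf_eq_zero [IsProbabilityMeasure μ] (h : CarriedBy μ M) {x : ℝ} (hx : x < -M) :
    cdf μ x = 0 := by
  rw [cdf_eq_real, Measure.real, measure_mono_null _ h, ENNReal.toReal_zero]
  intro y hy hy'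
  exact absurd (hy'.1.trans hy) (not_le.2 hx)

theorem cdf_eq_one [IsProbabilityMeasure μ] (h : CarriedBy μ M) {x : ℝ} (hx : M ≤ x) :
    cdf μ x = 1 := by
  rw [cdf_eq_real, ← sub_eq_zero, ← neg_eq_zero, neg_sub,
    ← probReal_compl_eq_one_sub measurableSet_Iic, Measure.real, measure_mono_null _ h,
    ENNReal.toReal_zero]
  intro y hy hy'
  exact hy (hy'.2.trans hx)

theorem ae_abs_le (h : CarriedBy μ M) : ∀ᵐ x ∂μ, |x| ≤ M := by
  filter_upwards [mem_ae_iff.2 h] with x hx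
  exact abs_le.2 hx

end CarriedBy

theorem exists_carriedBy {μ : Measure ℝ} (hμ : μ ∈ compactLaws) : ∃ M, 0 ≤ M ∧ CarriedBy μ M := by
  obtain ⟨-, K, hK, hK0⟩ := hμ
  obtain ⟨M, hM⟩ := hK.isBounded.exists_norm_le
  refine ⟨max M 0, le_max_right _ _, measure_mono_null (compl_subset_compl.2 ?_) hK0⟩
  intro x hx
  exact abs_le.1 ((hM x hx).trans (le_max_left _ _))

theorem CarriedBy.mem_compactLaws {μ : Measure ℝ} [IsProbabilityMeasure μ] {M : ℝ}
    (h : CarriedBy μ M) : μ ∈ compactLaws :=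
  ⟨inferInstance, _, isCompact_Icc, h⟩

theorem carriedBy_map {Ω : Type*} [MeasurableSpace Ω] {P : Measure Ω} {X : Ω → ℝ}
    (hm : Measurable X) {M : ℝ} (hX : ∀ᵐ ω ∂P, |X ω| ≤ M) : CarriedBy (P.map X) M := by
  rw [CarriedBy, Measure.map_apply hm measurableSet_Icc.compl]
  exact measure_mono_null (fun ω hω hle => hω (abs_le.1 hle)) hX

theorem boundedRV.exists_ae_abs_le {Ω : Type*} [MeasurableSpace Ω] {P : Measure Ω} {X : Ω → ℝ}
    (hX : X ∈ boundedRV P) : ∃ M, 0 ≤ M ∧ ∀ᵐ ω ∂P, |X ω| ≤ M := by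
  obtain ⟨-, C, hC⟩ := hX
  refine ⟨max C 0, le_max_right _ _, ?_⟩
  filter_upwards [hC] with ω hω
  exact hω.trans (le_max_left _ _)

section survival

variable (μ : Measure ℝ)

theorem one_sub_cdf_mem (x : ℝ) : 1 - cdf μ x ∈ Icc (0 : ℝ) 1 :=
  ⟨sub_nonneg.2 (cdf_le_one μ x), by linarith [cdf_nonneg μ x]⟩

theorem antitone_one_sub_cdf : Antitone fun x => 1 - cdf μ x :=
  fun _ _ hxy => sub_le_sub_left (monotone_cdf μ hxy) 1

variable {μ}

/-- By the Jordan decomposition `h` is a difference of monotone functions, and each composed with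
the survival function is antitone. -/
theorem BoundedVariationOn.intervalIntegrable_comp_cdf {h : ℝ → ℝ}
    (hbv : BoundedVariationOn h (Icc 0 1)) (a b : ℝ) :
    IntervalIntegrable (fun x => h (1 - cdf μ x)) volume a b := by
  obtain ⟨p, q, hp, hq, rfl⟩ :=
    hbv.locallyBoundedVariationOn.exists_monotoneOn_sub_monotoneOn
  have key : ∀ r : ℝ → ℝ, MonotoneOn r (Icc 0 1) →
      IntervalIntegrable (fun x => r (1 - cdf μ x)) volume a b := fun r hr =>
    Antitone.intervalIntegrable fun x y hxy =>
      hr (one_sub_cdf_mem μ y) (one_sub_cdf_mem μ x) (antitone_one_sub_cdf μ hxy)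
  exact (key p hp).sub (key q hq)

/-- Beyond `M` the integrand is `h 0 = 0`, below `-M` it is `h 1 - h 1`; the constant subtracted on
`[-M, 0]` accounts for `M * h 1`. Hypotheses on `cdf` alone suit laws known only through their
levels. -/
theorem signedChoquet_eq_of_cdf {h : ℝ → ℝ} (hh : IsDistortion h) {M : ℝ} (hM : 0 ≤ M)
    (hμ0 : ∀ x < -M, cdf μ x = 0) (hμ1 : ∀ x, M ≤ x → cdf μ x = 1) :
    signedChoquet h μ = (∫ x in (-M)..M, h (1 - cdf μ x)) - M * h 1 := by
  have hi := hh.bv.intervalIntegrable_comp_cdf (μ := μ)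
  have h1 : ∫ x in Ioi (0 : ℝ), h (1 - cdf μ x) = ∫ x in (0 : ℝ)..M, h (1 - cdf μ x) := by
    rw [intervalIntegral.integral_of_le hM]
    refine (setIntegral_eq_of_subset_of_forall_sdiff_eq_zero measurableSet_Ioi Ioc_subset_Ioi_self
      fun x hx => ?_)
    have : M ≤ x := by
      by_contra! hlt
      exact hx.2 ⟨hx.1, hlt.le⟩
    rw [hμ1 x this, sub_self, hh.zero]
  have h2 : ∫ x in Iio (0 : ℝ), (h (1 - cdf μ x) - h 1)
      = ∫ x in (-M)..0, (h (1 - cdf μ x) - h 1) := by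
    rw [intervalIntegral.integral_of_le (by linarith), ← integral_Iic_eq_integral_Iio,
      ← integral_Icc_eq_integral_Ioc]
    refine (setIntegral_eq_of_subset_of_forall_sdiff_eq_zero measurableSet_Iic Icc_subset_Iic_self
      fun x hx => ?_)
    have : x < -M := by
      by_contra! hlt
      exact hx.2 ⟨hlt, hx.1⟩
    rw [hμ0 x this, sub_zero, sub_self]
  rw [signedChoquet, h1, h2, intervalIntegral.integral_sub (hi _ _) intervalIntegrable_const,
    intervalIntegral.integral_const, ← intervalIntegral.integral_add_adjacent_intervals
      (hi (-M) 0) (hi 0 M)]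
  simp only [smul_eq_mul]
  ring

/-- The signed Choquet integral of a law carried by `[-M, M]`. -/
theorem signedChoquet_eq_intervalIntegral [IsProbabilityMeasure μ] {h : ℝ → ℝ}
    (hh : IsDistortion h) {M : ℝ} (hM : 0 ≤ M) (hμ : CarriedBy μ M) :
    signedChoquet h μ = (∫ x in (-M)..M, h (1 - cdf μ x)) - M * h 1 :=
  signedChoquet_eq_of_cdf hh hM (fun _ => hμ.cdf_eq_zero) fun _ => hμ.cdf_eq_one

end survival

/-! ### Upper-tail functionals -/

theorem isDistortion_min {s : ℝ} (hs : 0 ≤ s) : IsDistortion fun p => min p s := by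
  refine ⟨?_, min_eq_left hs⟩
  have hm : MonotoneOn (fun p : ℝ => min p s) (Icc 0 1) :=
    fun x _ y _ hxy => min_le_min_right s hxy
  have := hm.eVariationOn_eq (a := 0) (b := 1) (by simp) (by simp)
  rw [inter_self] at this
  rw [BoundedVariationOn, this]
  exact ENNReal.ofReal_ne_top

section upperTail

variable {μ : Measure ℝ} [IsProbabilityMeasure μ] {M : ℝ}

theorem CarriedBy.integrable_max (hμ : CarriedBy μ M) (y : ℝ) :
    Integrable (fun x => max (x - y) 0) μ := by
  refine Integrable.of_bound (by fun_prop) (M + |y|) ?_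
  filter_upwards [hμ.ae_abs_le] with x hx
  rw [Real.norm_eq_abs, abs_of_nonneg (le_max_right _ _)]
  refine max_le ?_ ?_
  · linarith [le_abs_self x, neg_abs_le y]
  · linarith [abs_nonneg x, abs_nonneg y]

/-- Layer-cake formula for `(X - y)⁺`, shifted by `y`. -/
theorem CarriedBy.integral_max (hμ : CarriedBy μ M) {y : ℝ} (hy : y ≤ M) :
    ∫ x, max (x - y) 0 ∂μ = ∫ x in y..M, (1 - cdf μ x) := by
  rw [(hμ.integrable_max y).integral_eq_integral_meas_lt
    (Filter.Eventually.of_forall fun x => le_max_right _ _)]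
  have e : ∀ t ∈ Ioi (0 : ℝ), μ.real {x | t < max (x - y) 0} = 1 - cdf μ (t + y) := by
    intro t ht
    rw [cdf_eq_real, ← probReal_compl_eq_one_sub measurableSet_Iic]
    congr 1
    ext x
    have ht' : (0 : ℝ) < t := ht
    simp only [mem_ofPred_eq, lt_max_iff, mem_compl_iff, mem_Iic, not_le]
    constructor
    · rintro (h | h) <;> linarith
    · intro h
      left
      linarith
  rw [setIntegral_congr_fun measurableSet_Ioi e]
  have h1 : ∫ t in Ioi (0 : ℝ), (1 - cdf μ (t + y)) = ∫ t in (0 : ℝ)..(M - y), (1 - cdf μ (t + y)) := by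
    rw [intervalIntegral.integral_of_le (by linarith)]
    refine (setIntegral_eq_of_subset_of_forall_sdiff_eq_zero measurableSet_Ioi Ioc_subset_Ioi_self
      fun x hx => ?_)
    have : M ≤ x + y := by
      by_contra! hlt
      exact hx.2 ⟨hx.1, by linarith⟩
    rw [hμ.cdf_eq_one this, sub_self]
  rw [h1, intervalIntegral.integral_comp_add_right (fun x => 1 - cdf μ x)]
  simp

/-- Split the integral at `y` and bound the minimum by `s` to the left and by the survival function
to the right. Together with the next lemma this is the variational formula for the upper tail. -/
theorem signedChoquet_min_le (hM : 0 ≤ M) (hμ : CarriedBy μ M) {s : ℝ} (hs : s ∈ Icc (0 : ℝ) 1)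
    {y : ℝ} (hy : y ∈ Icc (-M) M) :
    signedChoquet (fun p => min p s) μ ≤ s * y + ∫ x, max (x - y) 0 ∂μ := by
  have hd := isDistortion_min hs.1
  have hi := hd.bv.intervalIntegrable_comp_cdf (μ := μ)
  rw [signedChoquet_eq_intervalIntegral hd hM hμ, hμ.integral_max hy.2,
    ← intervalIntegral.integral_add_adjacent_intervals (hi (-M) y) (hi y M)]
  have h1 : ∫ x in (-M)..y, min (1 - cdf μ x) s ≤ ∫ _ in (-M)..y, s :=
    intervalIntegral.integral_mono_on hy.1 (hi _ _) intervalIntegrable_const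
      fun x _ => min_le_right _ _
  have h2 : ∫ x in y..M, min (1 - cdf μ x) s ≤ ∫ x in y..M, (1 - cdf μ x) :=
    intervalIntegral.integral_mono_on hy.2 (hi _ _) (antitone_one_sub_cdf μ).intervalIntegrable
      fun x _ => min_le_left _ _
  rw [intervalIntegral.integral_const, smul_eq_mul] at h1
  rw [min_eq_right hs.2]
  linarith

theorem exists_signedChoquet_min_eq (hM : 0 ≤ M) (hμ : CarriedBy μ M) {s : ℝ}
    (hs : s ∈ Icc (0 : ℝ) 1) :
    ∃ y ∈ Icc (-M) M,
      signedChoquet (fun p => min p s) μ = s * y + ∫ x, max (x - y) 0 ∂μ := by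
  have hd := isDistortion_min hs.1
  have hi := hd.bv.intervalIntegrable_comp_cdf (μ := μ)
  -- The infimum of `A` is the point where the survival function drops to `s`, so both bounds of the
  -- previous lemma are attained there up to null sets.
  set A : Set ℝ := {x | -M ≤ x ∧ 1 - cdf μ x ≤ s} with hA
  have hMA : M ∈ A := ⟨by linarith, by rw [hμ.cdf_eq_one le_rfl, sub_self]; exact hs.1⟩
  have hbd : BddBelow A := ⟨-M, fun x hx => hx.1⟩
  have hy : sInf A ∈ Icc (-M) M := ⟨le_csInf ⟨M, hMA⟩ fun x hx => hx.1, csInf_le hbd hMA⟩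
  refine ⟨sInf A, hy, ?_⟩
  set y := sInf A
  rw [signedChoquet_eq_intervalIntegral hd hM hμ, hμ.integral_max hy.2,
    ← intervalIntegral.integral_add_adjacent_intervals (hi (-M) y) (hi y M)]
  have h1 : ∫ x in (-M)..y, min (1 - cdf μ x) s = ∫ _ in (-M)..y, s := by
    rw [intervalIntegral.integral_of_le hy.1, intervalIntegral.integral_of_le hy.1,
      integral_Ioc_eq_integral_Ioo, integral_Ioc_eq_integral_Ioo]
    refine setIntegral_congr_fun measurableSet_Ioo fun x hx => min_eq_right ?_
    by_contra! hlt
    exact absurd (csInf_le hbd ⟨hx.1.le, hlt.le⟩) (not_le.2 hx.2)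
  have h2 : ∫ x in y..M, min (1 - cdf μ x) s = ∫ x in y..M, (1 - cdf μ x) := by
    rw [intervalIntegral.integral_of_le hy.2, intervalIntegral.integral_of_le hy.2]
    refine setIntegral_congr_fun measurableSet_Ioc fun x hx => min_eq_left ?_
    obtain ⟨z, hz, hzx⟩ := (csInf_lt_iff hbd ⟨M, hMA⟩).1 hx.1
    exact (antitone_one_sub_cdf μ hzx.le).trans hz.2
  rw [intervalIntegral.integral_const, smul_eq_mul] at h1
  rw [h1, h2, min_eq_right hs.2]
  ring

theorem CarriedBy.integrable_id (hμ : CarriedBy μ M) : Integrable (fun x : ℝ => x) μ :=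
  Integrable.of_bound (by fun_prop) M (by simpa using hμ.ae_abs_le)

theorem signedChoquet_min_one (hM : 0 ≤ M) (hμ : CarriedBy μ M) :
    signedChoquet (fun p => min p 1) μ = ∫ x, x ∂μ := by
  have e : ∫ x, max (x - -M) 0 ∂μ = (∫ x, x ∂μ) + M := by
    have : ∫ x, max (x - -M) 0 ∂μ = ∫ x, (x + M) ∂μ := by
      refine integral_congr_ae ?_
      filter_upwards [hμ.ae_abs_le] with x hx
      rw [max_eq_left (by linarith [(abs_le.1 hx).1]), sub_neg_eq_add]
    rw [this, integral_add hμ.integrable_id (integrable_const _)]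
    simp
  rw [hμ.integral_max (by linarith)] at e
  have hd := isDistortion_min (zero_le_one' ℝ)
  rw [signedChoquet_eq_intervalIntegral hd hM hμ]
  have : ∀ x, min (1 - cdf μ x) 1 = 1 - cdf μ x := fun x => min_eq_left (one_sub_cdf_mem μ x).2
  simp only [this, e, min_self]
  ring

theorem signedChoquet_min_zero (hM : 0 ≤ M) (hμ : CarriedBy μ M) :
    signedChoquet (fun p => min p 0) μ = 0 := by
  rw [signedChoquet_eq_intervalIntegral (isDistortion_min le_rfl) hM hμ]
  have : ∀ x, min (1 - cdf μ x) 0 = 0 := fun x => min_eq_right (one_sub_cdf_mem μ x).1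
  simp [this]

end upperTail

/-! ### Piecewise linear approximation of convex distortions -/

/-- The slope of `h` on `[i / n, (i + 1) / n]`. -/
noncomputable def gridSlope (h : ℝ → ℝ) (n i : ℕ) : ℝ :=
  n * (h ((i + 1 : ℕ) / n) - h (i / n))

/-- The piecewise linear interpolation of `h` at the points `i / n`. -/
noncomputable def gridInterp (h : ℝ → ℝ) (n : ℕ) (p : ℝ) : ℝ :=
  ∑ i ∈ Finset.range n, gridSlope h n i * (min p ((i + 1 : ℕ) / n) - min p (i / n))

theorem gridInterp_eq {h : ℝ → ℝ} (h0 : h 0 = 0) {n k : ℕ} (hk : k < n) {p : ℝ}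
    (hp : p ∈ Icc ((k : ℝ) / n) ((k + 1 : ℕ) / n)) :
    gridInterp h n p = h (k / n) + gridSlope h n k * (p - k / n) := by
  have hn : (0 : ℝ) < n := by exact_mod_cast (Nat.zero_le k).trans_lt hk
  have hle : ∀ i j : ℕ, i ≤ j → (i : ℝ) / n ≤ j / n := fun i j hij => by gcongr
  have low : ∀ m ≤ k, ∑ i ∈ Finset.range m,
      gridSlope h n i * (min p ((i + 1 : ℕ) / n) - min p (i / n)) = h (m / n) := by
    intro m
    induction m with
    | zero => simp [h0]
    | succ m ih =>
      intro hm
      rw [Finset.sum_range_succ, ih (by omega), min_eq_right ((hle _ _ hm).trans hp.1),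
        min_eq_right ((hle m k (by omega)).trans hp.1), gridSlope]
      push_cast
      field_simp
      ring
  have high : ∀ m, k + 1 ≤ m → ∑ i ∈ Finset.range m,
      gridSlope h n i * (min p ((i + 1 : ℕ) / n) - min p (i / n))
        = h (k / n) + gridSlope h n k * (p - k / n) := by
    intro m hm
    induction m, hm using Nat.le_induction with
    | base => rw [Finset.sum_range_succ, low k le_rfl, min_eq_left hp.2, min_eq_right hp.1]
    | succ m hm ih =>
      rw [Finset.sum_range_succ, ih, min_eq_left (hp.2.trans (hle _ _ hm)),
        min_eq_left (hp.2.trans (hle _ _ (by omega))), sub_self, mul_zero, add_zero]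
  exact high n hk

theorem exists_gridInterp_eq {h : ℝ → ℝ} (h0 : h 0 = 0) {n : ℕ} (hn : 0 < n) {p : ℝ}
    (hp : p ∈ Icc (0 : ℝ) 1) :
    ∃ u ∈ Icc (0 : ℝ) 1, ∃ v ∈ Icc (0 : ℝ) 1, ∃ w ∈ Icc (0 : ℝ) 1,
      |u - p| ≤ 1 / n ∧ |v - p| ≤ 1 / n ∧ gridInterp h n p = (1 - w) * h u + w * h v := by
  have hn' : (0 : ℝ) < n := by exact_mod_cast hn
  obtain ⟨k, hk, h1, h2⟩ : ∃ k : ℕ, k < n ∧ (k : ℝ) ≤ n * p ∧ n * p ≤ k + 1 := by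
    -- At `p = 1` the floor would give the nonexistent cell `n`; the last cell is used instead.
    rcases hp.2.lt_or_eq with hlt | rfl
    · refine ⟨⌊n * p⌋₊, ?_, Nat.floor_le (mul_nonneg hn'.le hp.1), (Nat.lt_floor_add_one _).le⟩
      rw [Nat.floor_lt (mul_nonneg hn'.le hp.1)]
      nlinarith
    · obtain ⟨m, rfl⟩ : ∃ m, n = m + 1 := ⟨n - 1, by omega⟩
      exact ⟨m, by omega, by push_cast; linarith, by push_cast; linarith⟩
  have hk' : (k : ℝ) + 1 ≤ n := by exact_mod_cast hk
  have e1 : (k : ℝ) / n ≤ p := by rw [div_le_iff₀ hn']; linarith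
  have e2 : p ≤ ((k + 1 : ℕ) : ℝ) / n := by rw [le_div_iff₀ hn']; push_cast; linarith
  have e3 : ((k + 1 : ℕ) : ℝ) / n = k / n + 1 / n := by push_cast; ring
  refine ⟨k / n, ⟨by positivity, e1.trans hp.2⟩, (k + 1 : ℕ) / n, ⟨by positivity, ?_⟩,
    n * p - k, ⟨by linarith, by linarith⟩, ?_, ?_, ?_⟩
  · rw [div_le_one hn']
    exact_mod_cast hk
  · rw [abs_le]
    constructor <;> linarith
  · rw [abs_le]
    constructor <;> linarith
  · rw [gridInterp_eq h0 hk ⟨e1, e2⟩, gridSlope]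
    field_simp
    ring

theorem abs_gridInterp_le {h : ℝ → ℝ} (h0 : h 0 = 0) {B : ℝ}
    (hB : ∀ x ∈ Icc (0 : ℝ) 1, |h x| ≤ B) {n : ℕ} (hn : 0 < n) {p : ℝ} (hp : p ∈ Icc (0 : ℝ) 1) :
    |gridInterp h n p| ≤ B := by
  obtain ⟨u, hu, v, hv, w, hw, -, -, e⟩ := exists_gridInterp_eq h0 hn hp
  rw [e, abs_le]
  have h1 := abs_le.1 (hB u hu)
  have h2 := abs_le.1 (hB v hv)
  constructor <;> nlinarith [hw.1, hw.2]

theorem gridInterp_one {h : ℝ → ℝ} (h0 : h 0 = 0) {n : ℕ} (hn : 0 < n) :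
    gridInterp h n 1 = h 1 := by
  have hn' : (0 : ℝ) < n := by exact_mod_cast hn
  obtain ⟨m, rfl⟩ : ∃ m, n = m + 1 := ⟨n - 1, by omega⟩
  have e : ((m + 1 : ℕ) : ℝ) / (m + 1 : ℕ) = 1 := div_self hn'.ne'
  rw [gridInterp_eq h0 (Nat.lt_succ_self m) (p := 1) ⟨?_, e.ge⟩, gridSlope, e]
  · field_simp
    push_cast
    ring
  · rw [div_le_one hn']
    push_cast
    linarith

theorem tendsto_gridInterp {h : ℝ → ℝ} (h0 : h 0 = 0) (hc : ConvexOn ℝ (Icc 0 1) h) {p : ℝ}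
    (hp : p ∈ Icc (0 : ℝ) 1) :
    Filter.Tendsto (fun n => gridInterp h n p) Filter.atTop (nhds (h p)) := by
  -- A convex function may jump at `0` and at `1`. The interpolation is exact there, and continuity
  -- is needed only in the interior.
  rcases hp.1.eq_or_lt with rfl | hp0
  · refine tendsto_const_nhds.congr fun n => ?_
    have hmin : ∀ i : ℕ, min (0 : ℝ) ((i : ℝ) / n) = 0 := fun i => min_eq_left (by positivity)
    simp only [gridInterp, hmin, sub_self, mul_zero, Finset.sum_const_zero, h0]
  rcases hp.2.eq_or_lt with rfl | hp1
  · refine tendsto_const_nhds.congr' ?_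
    filter_upwards [Filter.eventually_gt_atTop 0] with n hn
    exact (gridInterp_one h0 hn).symm
  have hcont : ContinuousAt h p := by
    have := hc.continuousOn_interior
    rw [interior_Icc] at this
    exact this.continuousAt (Ioo_mem_nhds hp0 hp1)
  rw [Metric.tendsto_nhds]
  intro ε hε
  obtain ⟨δ, hδ, hδ'⟩ := Metric.continuousAt_iff.1 hcont (ε / 2) (half_pos hε)
  obtain ⟨N, hN⟩ := exists_nat_one_div_lt hδ
  filter_upwards [Filter.eventually_gt_atTop N] with n hn
  obtain ⟨u, -, v, -, w, hw, hu, hv, e⟩ := exists_gridInterp_eq h0 (by omega : 0 < n) hp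
  have hlt : (1 : ℝ) / n < δ := by
    refine lt_of_le_of_lt ?_ hN
    have : (N : ℝ) + 1 ≤ n := by exact_mod_cast hn
    exact one_div_le_one_div_of_le (by positivity) this
  have h1 := hδ' (x := u) (by rw [Real.dist_eq]; linarith)
  have h2 := hδ' (x := v) (by rw [Real.dist_eq]; linarith)
  rw [Real.dist_eq] at h1 h2 ⊢
  rw [e]
  have h1 := abs_lt.1 h1
  have h2 := abs_lt.1 h2
  refine lt_of_le_of_lt (abs_le.2 ⟨?_, ?_⟩) (half_lt_self hε) <;> nlinarith [hw.1, hw.2]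

theorem BoundedVariationOn.exists_abs_le {h : ℝ → ℝ} (hbv : BoundedVariationOn h (Icc 0 1)) :
    ∃ B, ∀ x ∈ Icc (0 : ℝ) 1, |h x| ≤ B := by
  refine ⟨|h 0| + (eVariationOn h (Icc 0 1)).toReal, fun x hx => ?_⟩
  have h0 : (0 : ℝ) ∈ Icc (0 : ℝ) 1 := by simp
  have := hbv.dist_le hx h0
  rw [Real.dist_eq] at this
  have := abs_add_le (h x - h 0) (h 0)
  rw [sub_add_cancel] at this
  linarith

/-- The signed Choquet integral as a limit of combinations of upper-tail functionals. -/
theorem tendsto_sum_signedChoquet_min {h : ℝ → ℝ} (hh : IsDistortion h)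
    (hc : ConvexOn ℝ (Icc 0 1) h) {μ : Measure ℝ} [IsProbabilityMeasure μ] {M : ℝ} (hM : 0 ≤ M)
    (hμ : CarriedBy μ M) :
    Filter.Tendsto (fun n : ℕ => ∑ i ∈ Finset.range n, gridSlope h n i *
        (signedChoquet (fun p => min p ((i + 1 : ℕ) / n)) μ
          - signedChoquet (fun p => min p (i / n)) μ))
      Filter.atTop (nhds (signedChoquet h μ)) := by
  obtain ⟨B, hB⟩ := hh.bv.exists_abs_le
  have hi : ∀ n i : ℕ, IntervalIntegrable (fun x => min (1 - cdf μ x) ((i : ℝ) / n)) volume (-M) M :=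
    fun n i => (isDistortion_min (by positivity : (0 : ℝ) ≤ i / n)).bv.intervalIntegrable_comp_cdf _ _
  have hterm : ∀ n i : ℕ, IntervalIntegrable (fun x => gridSlope h n i *
      (min (1 - cdf μ x) ((i + 1 : ℕ) / n) - min (1 - cdf μ x) (i / n))) volume (-M) M :=
    fun n i => ((hi n (i + 1)).sub (hi n i)).const_mul _
  have hsum : ∀ n : ℕ, 0 < n → (∫ x in (-M)..M, gridInterp h n (1 - cdf μ x)) - M * h 1
      = ∑ i ∈ Finset.range n, gridSlope h n i *
        (signedChoquet (fun p => min p ((i + 1 : ℕ) / n)) μ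
          - signedChoquet (fun p => min p (i / n)) μ) := by
    intro n hn
    rw [← gridInterp_one hh.zero hn]
    simp only [gridInterp]
    rw [intervalIntegral.integral_finsetSum fun i _ => hterm n i, Finset.mul_sum,
      ← Finset.sum_sub_distrib]
    refine Finset.sum_congr rfl fun i _ => ?_
    rw [signedChoquet_eq_intervalIntegral (isDistortion_min (by positivity)) hM hμ,
      signedChoquet_eq_intervalIntegral (isDistortion_min (by positivity)) hM hμ,
      intervalIntegral.integral_const_mul, intervalIntegral.integral_sub (hi n (i + 1)) (hi n i)]
    ring
  rw [signedChoquet_eq_intervalIntegral hh hM hμ]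
  refine Filter.Tendsto.congr' (f₁ := fun n : ℕ =>
    (∫ x in (-M)..M, gridInterp h n (1 - cdf μ x)) - M * h 1) ?_ (Filter.Tendsto.sub_const ?_ _)
  · filter_upwards [Filter.eventually_gt_atTop 0] with n hn
    exact hsum n hn
  · refine intervalIntegral.tendsto_integral_filter_of_dominated_convergence (fun _ => B) ?_ ?_
      intervalIntegrable_const ?_
    · filter_upwards with n
      have : IntervalIntegrable (fun x => gridInterp h n (1 - cdf μ x)) volume (-M) M := by
        simpa only [Finset.sum_fn] using!
          IntervalIntegrable.sum (Finset.range n) fun i _ => hterm n i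
      exact this.def'.aestronglyMeasurable
    · filter_upwards [Filter.eventually_gt_atTop 0] with n hn
      exact Filter.Eventually.of_forall fun x _ =>
        abs_gridInterp_le hh.zero hB hn (one_sub_cdf_mem μ x)
    · exact Filter.Eventually.of_forall fun x _ =>
        tendsto_gridInterp hh.zero hc (one_sub_cdf_mem μ x)

theorem gridSlope_mono {h : ℝ → ℝ} (hc : ConvexOn ℝ (Icc 0 1) h) {n i : ℕ} (hi : i + 1 < n) :
    gridSlope h n i ≤ gridSlope h n (i + 1) := by
  have hn : (0 : ℝ) < n := by exact_mod_cast (Nat.zero_le _).trans_lt hi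
  have hmem : ∀ j : ℕ, j ≤ n → (j : ℝ) / n ∈ Icc (0 : ℝ) 1 := fun j hj =>
    ⟨by positivity, by rw [div_le_one hn]; exact_mod_cast hj⟩
  have := hc.2 (hmem i (by omega)) (hmem (i + 1 + 1) (by omega)) (half_pos one_pos).le
    (half_pos one_pos).le (add_halves 1)
  have e : (1 / 2 : ℝ) • ((i : ℝ) / n) + (1 / 2 : ℝ) • (((i + 1 + 1 : ℕ) : ℝ) / n)
      = ((i + 1 : ℕ) : ℝ) / n := by
    simp only [smul_eq_mul]
    push_cast
    ring
  rw [e] at this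
  simp only [smul_eq_mul] at this
  exact mul_le_mul_of_nonneg_left (by linarith) hn.le

/-- Summation by parts: increasing slopes against a nonpositive function vanishing at both ends. -/
theorem sum_gridSlope_mul_nonneg {h : ℝ → ℝ} (hc : ConvexOn ℝ (Icc 0 1) h) {n : ℕ} {φ : ℝ → ℝ}
    (hφ : ∀ s ∈ Icc (0 : ℝ) 1, φ s ≤ 0) (hφ0 : φ 0 = 0) (hφ1 : φ 1 = 0) :
    0 ≤ ∑ i ∈ Finset.range n, gridSlope h n i * (φ ((i + 1 : ℕ) / n) - φ (i / n)) := by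
  rcases n with _ | m
  · simp
  have hn : (0 : ℝ) < (m + 1 : ℕ) := by positivity
  -- The induction step reduces to `(slope k - slope (k + 1)) * φ ((k + 1) / n) ≥ 0` with `n = m +
  -- 1`, a product of nonpositive factors.
  have key : ∀ k ≤ m, gridSlope h (m + 1) k * φ ((k + 1 : ℕ) / (m + 1 : ℕ)) ≤
      ∑ i ∈ Finset.range (k + 1), gridSlope h (m + 1) i *
        (φ ((i + 1 : ℕ) / (m + 1 : ℕ)) - φ (i / (m + 1 : ℕ))) := by
    intro k
    induction k with
    | zero => simp [hφ0]
    | succ k ih =>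
      intro hk
      rw [Finset.sum_range_succ]
      have h1 := ih (by omega)
      have h2 := gridSlope_mono hc (n := m + 1) (i := k) (by omega)
      have h3 : φ ((k + 1 : ℕ) / (m + 1 : ℕ)) ≤ 0 := hφ _ ⟨by positivity, by
        rw [div_le_one hn]; exact_mod_cast (by omega : k + 1 ≤ m + 1)⟩
      nlinarith [mul_nonneg_of_nonpos_of_nonpos (sub_nonpos.2 h2) h3]
  have := key m le_rfl
  rwa [div_self hn.ne', hφ1, mul_zero] at this

/-- An inequality for all upper-tail functionals, with equality for the mean, passes to all convex
distortions. -/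
theorem add_signedChoquet_le_of_min {h : ℝ → ℝ} (hh : IsDistortion h)
    (hc : ConvexOn ℝ (Icc 0 1) h) {μ₁ μ₂ ν : Measure ℝ} [IsProbabilityMeasure μ₁]
    [IsProbabilityMeasure μ₂] [IsProbabilityMeasure ν] {M : ℝ} (hM : 0 ≤ M)
    (h₁ : CarriedBy μ₁ M) (h₂ : CarriedBy μ₂ M) (h₃ : CarriedBy ν M)
    (hmean : ∫ x, x ∂ν = (∫ x, x ∂μ₁) + ∫ x, x ∂μ₂)
    (hmin : ∀ s ∈ Icc (0 : ℝ) 1, signedChoquet (fun p => min p s) ν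
      ≤ signedChoquet (fun p => min p s) μ₁ + signedChoquet (fun p => min p s) μ₂) :
    signedChoquet h μ₁ + signedChoquet h μ₂ ≤ signedChoquet h ν := by
  refine le_of_tendsto_of_tendsto' ((tendsto_sum_signedChoquet_min hh hc hM h₁).add
    (tendsto_sum_signedChoquet_min hh hc hM h₂)) (tendsto_sum_signedChoquet_min hh hc hM h₃)
    fun n => ?_
  have := sum_gridSlope_mul_nonneg hc (n := n) (φ := fun s => signedChoquet (fun p => min p s) ν
    - signedChoquet (fun p => min p s) μ₁ - signedChoquet (fun p => min p s) μ₂)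
    (fun s hs => by linarith [hmin s hs])
    (by simp only [signedChoquet_min_zero hM h₁, signedChoquet_min_zero hM h₂,
      signedChoquet_min_zero hM h₃, sub_zero])
    (by
      simp only [signedChoquet_min_one hM h₁, signedChoquet_min_one hM h₂,
        signedChoquet_min_one hM h₃]
      linarith)
  rw [← sub_nonneg, ← Finset.sum_add_distrib, ← Finset.sum_sub_distrib]
  refine this.trans_eq (Finset.sum_congr rfl fun i _ => ?_)
  ring

/-! ### Convexity implies the order, superadditivity and mixture properties -/

theorem carriedBy_dirac_zero : CarriedBy (Measure.dirac 0) 0 := by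
  rw [CarriedBy, Measure.dirac_apply' _ measurableSet_Icc.compl]
  simp

theorem signedChoquet_dirac_zero {h : ℝ → ℝ} (hh : IsDistortion h) :
    signedChoquet h (Measure.dirac 0) = 0 := by
  rw [signedChoquet_eq_intervalIntegral hh le_rfl carriedBy_dirac_zero]
  simp

theorem concaveOrderMonotone_of_convexOn {h : ℝ → ℝ} (hh : IsDistortion h)
    (hc : ConvexOn ℝ (Icc 0 1) h) : ConcaveOrderMonotone (signedChoquet h) := by
  intro μ hμ ν hν hle
  have := hμ.1
  have := hν.1
  obtain ⟨M₁, h0, h1⟩ := exists_carriedBy hμ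
  obtain ⟨M₂, -, h2⟩ := exists_carriedBy hν
  replace h0 : 0 ≤ max M₁ M₂ := h0.trans (le_max_left _ _)
  replace h1 := h1.mono (le_max_left M₁ M₂)
  replace h2 := h2.mono (le_max_right M₁ M₂)
  -- The point mass at `0` contributes nothing and reduces the two-law inequality to a comparison of
  -- `μ` with `ν`. The functions `x` and `-x` give equal means, and `-(x - y)⁺` compares the tails
  -- at the optimal `y` for `μ`.
  have key := add_signedChoquet_le_of_min hh hc h0 h1 (carriedBy_dirac_zero.mono h0) h2 ?_ ?_
  · rwa [signedChoquet_dirac_zero hh, add_zero] at key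
  · have e1 := hle (fun x => x) (concaveOn_id convex_univ)
    have e2 := hle (fun x => -x) (convexOn_id convex_univ).neg
    rw [integral_neg fun x : ℝ => x, integral_neg fun x : ℝ => x] at e2
    rw [integral_dirac]
    linarith
  · intro s hs
    rw [signedChoquet_dirac_zero (isDistortion_min hs.1), add_zero]
    obtain ⟨y, hy, e⟩ := exists_signedChoquet_min_eq h0 h1 hs
    have e1 := signedChoquet_min_le h0 h2 hs hy
    have hconv : ConvexOn ℝ univ fun x : ℝ => max (x - y) 0 :=
      ((convexOn_id convex_univ).sub (concaveOn_const y convex_univ)).sup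
        (convexOn_const 0 convex_univ)
    have e2 := hle (fun x => -max (x - y) 0) hconv.neg
    simp only [integral_neg] at e2
    linarith

theorem smul_mem_boundedRV {Ω : Type*} [MeasurableSpace Ω] {P : Measure Ω} {X : Ω → ℝ}
    (hX : X ∈ boundedRV P) (t : ℝ) : t • X ∈ boundedRV P := by
  obtain ⟨hm, C, hC⟩ := hX
  refine ⟨hm.const_smul t, |t| * C, ?_⟩
  filter_upwards [hC] with ω hω
  rw [Pi.smul_apply, smul_eq_mul, abs_mul]
  exact mul_le_mul_of_nonneg_left hω (abs_nonneg t)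

theorem OConcave.oQuasiConcave {Ω : Type*} [MeasurableSpace Ω] {P : Measure Ω} {ρ : (Ω → ℝ) → ℝ} 
    (hs : OConcave P ρ) : OQuasiConcave P ρ := by
  intro X hX Y hY t ht
  refine le_trans ?_ (hs X hX Y hY t ht)
  have h1 := mul_le_mul_of_nonneg_left (min_le_left (ρ X) (ρ Y)) ht.1
  have h2 := mul_le_mul_of_nonneg_left (min_le_right (ρ X) (ρ Y)) (sub_nonneg.2 ht.2)
  linarith

section randomVariables

variable {Ω : Type*} [MeasurableSpace Ω] {P : Measure Ω} [IsProbabilityMeasure P]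

theorem oSuperadditive_of_convexOn {h : ℝ → ℝ} (hh : IsDistortion h)
    (hc : ConvexOn ℝ (Icc 0 1) h) : OSuperadditive P (signedChoquetRV P h) := by
  intro X hX Y hY
  obtain ⟨M₁, m1, h1⟩ := boundedRV.exists_ae_abs_le hX
  obtain ⟨M₂, m2, h2⟩ := boundedRV.exists_ae_abs_le hY
  have hXY : Measurable (X + Y) := hX.1.add hY.1
  have := Measure.isProbabilityMeasure_map (μ := P) hX.1.aemeasurable
  have := Measure.isProbabilityMeasure_map (μ := P) hY.1.aemeasurable
  have := Measure.isProbabilityMeasure_map (μ := P) hXY.aemeasurable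
  have c1 := carriedBy_map hX.1 h1
  have c2 := carriedBy_map hY.1 h2
  have c3 : CarriedBy (P.map (X + Y)) (M₁ + M₂) := by
    refine carriedBy_map hXY ?_
    filter_upwards [h1, h2] with ω a b
    exact (abs_add_le _ _).trans (add_le_add a b)
  have i1 : ∀ y, Integrable (fun ω => max (X ω - y) 0) P := fun y =>
    (c1.integrable_max y).comp_measurable hX.1
  have i2 : ∀ y, Integrable (fun ω => max (Y ω - y) 0) P := fun y =>
    (c2.integrable_max y).comp_measurable hY.1
  have i3 : ∀ y, Integrable (fun ω => max ((X + Y) ω - y) 0) P := fun y =>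
    (c3.integrable_max y).comp_measurable hXY
  refine add_signedChoquet_le_of_min hh hc (add_nonneg m1 m2) (c1.mono (by linarith))
    (c2.mono (by linarith)) c3 ?_ ?_
  · rw [integral_map hX.1.aemeasurable (by fun_prop), integral_map hY.1.aemeasurable (by fun_prop),
      integral_map hXY.aemeasurable (by fun_prop)]
    exact integral_add (c1.integrable_id.comp_measurable hX.1)
      (c2.integrable_id.comp_measurable hY.1)
  · intro s hs
    obtain ⟨y, hy, e1⟩ := exists_signedChoquet_min_eq m1 c1 hs
    obtain ⟨z, hz, e2⟩ := exists_signedChoquet_min_eq m2 c2 hs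
    have e3 := signedChoquet_min_le (add_nonneg m1 m2) c3 hs (y := y + z)
      ⟨by linarith [hy.1, hz.1], by linarith [hy.2, hz.2]⟩
    rw [integral_map hX.1.aemeasurable (by fun_prop)] at e1
    rw [integral_map hY.1.aemeasurable (by fun_prop)] at e2
    rw [integral_map hXY.aemeasurable (by fun_prop)] at e3
    -- Subadditivity of the positive part, with `y` and `z` optimal for `X` and `Y`; their sum need
    -- not be optimal for `X + Y`.
    have e4 : ∫ ω, max ((X + Y) ω - (y + z)) 0 ∂P
        ≤ (∫ ω, max (X ω - y) 0 ∂P) + ∫ ω, max (Y ω - z) 0 ∂P := by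
      rw [← integral_add (i1 y) (i2 z)]
      refine integral_mono (i3 _) ((i1 y).add (i2 z)) fun ω => ?_
      refine max_le ?_ (add_nonneg (le_max_right _ _) (le_max_right _ _))
      have a := le_max_left (X ω - y) 0
      have b := le_max_left (Y ω - z) 0
      simp only [Pi.add_apply]
      linarith
    linarith

theorem signedChoquetRV_smul {h : ℝ → ℝ} (hh : IsDistortion h) {X : Ω → ℝ} (hX : X ∈ boundedRV P)
    {t : ℝ} (ht : 0 ≤ t) : signedChoquetRV P h (t • X) = t * signedChoquetRV P h X := by
  rcases ht.eq_or_lt with rfl | ht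
  · have : P.map ((0 : ℝ) • X) = Measure.dirac 0 := by
      rw [zero_smul]
      have := Measure.map_const P (0 : ℝ)
      rw [measure_univ, one_smul] at this
      exact this
    rw [signedChoquetRV, this, signedChoquet_dirac_zero hh, zero_mul]
  obtain ⟨M, m, hM⟩ := boundedRV.exists_ae_abs_le hX
  have htX : Measurable (t • X) := hX.1.const_smul t
  have := Measure.isProbabilityMeasure_map (μ := P) hX.1.aemeasurable
  have := Measure.isProbabilityMeasure_map (μ := P) htX.aemeasurable
  have c : CarriedBy (P.map (t • X)) (t * M) := by
    refine carriedBy_map htX ?_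
    filter_upwards [hM] with ω hω
    rw [Pi.smul_apply, smul_eq_mul, abs_mul, abs_of_pos ht]
    exact mul_le_mul_of_nonneg_left hω ht.le
  have hcdf : ∀ x, cdf (P.map (t • X)) x = cdf (P.map X) (x / t) := by
    intro x
    rw [cdf_eq_real, cdf_eq_real, map_measureReal_apply htX measurableSet_Iic,
      map_measureReal_apply hX.1 measurableSet_Iic]
    congr 1
    ext ω
    simp only [mem_preimage, mem_Iic, Pi.smul_apply, smul_eq_mul]
    rw [le_div_iff₀ ht, mul_comm]
  rw [signedChoquetRV, signedChoquetRV, signedChoquet_eq_intervalIntegral hh (by positivity) c,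
    signedChoquet_eq_intervalIntegral hh m (carriedBy_map hX.1 hM)]
  simp only [hcdf]
  rw [intervalIntegral.integral_comp_div (fun x => h (1 - cdf (P.map X) x)) ht.ne',
    show -(t * M) / t = -M by field_simp, show t * M / t = M by field_simp, smul_eq_mul]
  ring

theorem OSuperadditive.oConcave {h : ℝ → ℝ} (hh : IsDistortion h)
    (hs : OSuperadditive P (signedChoquetRV P h)) : OConcave P (signedChoquetRV P h) := by
  intro X hX Y hY t ht
  rw [← signedChoquetRV_smul hh hX ht.1, ← signedChoquetRV_smul hh hY (sub_nonneg.2 ht.2)]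
  exact hs _ (smul_mem_boundedRV hX _) _ (smul_mem_boundedRV hY _)

end randomVariables

theorem isProbabilityMeasure_mixture {μ ν : Measure ℝ} [IsProbabilityMeasure μ]
    [IsProbabilityMeasure ν] {t : ℝ} (ht : t ∈ Icc (0 : ℝ) 1) :
    IsProbabilityMeasure (mixture t μ ν) := ⟨by
  simp only [mixture, Measure.add_apply, Measure.smul_apply, measure_univ, smul_eq_mul, mul_one]
  rw [← ENNReal.ofReal_add ht.1 (sub_nonneg.2 ht.2)]
  simp⟩

theorem CarriedBy.mixture {μ ν : Measure ℝ} {M : ℝ} (hμ : CarriedBy μ M) (hν : CarriedBy ν M)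
    (t : ℝ) : CarriedBy (mixture t μ ν) M := by
  rw [CarriedBy] at *
  simp [_root_.mixture, hμ, hν]

theorem mConvex_of_convexOn {h : ℝ → ℝ} (hh : IsDistortion h) (hc : ConvexOn ℝ (Icc 0 1) h) :
    MConvex (signedChoquet h) := by
  intro μ hμ ν hν t ht
  have := hμ.1
  have := hν.1
  have := isProbabilityMeasure_mixture (μ := μ) (ν := ν) ht
  obtain ⟨M₁, h0, h1⟩ := exists_carriedBy hμ
  obtain ⟨M₂, -, h2⟩ := exists_carriedBy hν
  replace h0 : 0 ≤ max M₁ M₂ := h0.trans (le_max_left _ _)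
  replace h1 := h1.mono (le_max_left M₁ M₂)
  replace h2 := h2.mono (le_max_right M₁ M₂)
  rw [signedChoquet_eq_intervalIntegral hh h0 h1, signedChoquet_eq_intervalIntegral hh h0 h2,
    signedChoquet_eq_intervalIntegral hh h0 (h1.mixture h2 t)]
  have i1 := hh.bv.intervalIntegrable_comp_cdf (μ := μ) (-max M₁ M₂) (max M₁ M₂)
  have i2 := hh.bv.intervalIntegrable_comp_cdf (μ := ν) (-max M₁ M₂) (max M₁ M₂)
  have key : ∫ x in (-max M₁ M₂)..(max M₁ M₂), h (1 - cdf (mixture t μ ν) x) ≤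
      ∫ x in (-max M₁ M₂)..(max M₁ M₂), (t * h (1 - cdf μ x) + (1 - t) * h (1 - cdf ν x)) := by
    refine intervalIntegral.integral_mono_on (by linarith)
      (hh.bv.intervalIntegrable_comp_cdf _ _) ((i1.const_mul t).add (i2.const_mul (1 - t)))
      fun x _ => ?_
    have := hc.2 (one_sub_cdf_mem μ x) (one_sub_cdf_mem ν x) ht.1 (sub_nonneg.2 ht.2) (by ring)
    simp only [smul_eq_mul] at this
    rwa [cdf_mixture μ ν ht, show 1 - (t * cdf μ x + (1 - t) * cdf ν x)
      = t * (1 - cdf μ x) + (1 - t) * (1 - cdf ν x) by ring]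
  rw [intervalIntegral.integral_add (i1.const_mul t) (i2.const_mul (1 - t)),
    intervalIntegral.integral_const_mul, intervalIntegral.integral_const_mul] at key
  linarith

theorem MConvex.mQuasiConvex {ρ : Measure ℝ → ℝ} (hρ : MConvex ρ) : MQuasiConvex ρ := by
  intro μ hμ ν hν t ht
  refine (hρ μ hμ ν hν t ht).trans ?_
  have h1 := mul_le_mul_of_nonneg_left (le_max_left (ρ μ) (ρ ν)) ht.1
  have h2 := mul_le_mul_of_nonneg_left (le_max_right (ρ μ) (ρ ν)) (sub_nonneg.2 ht.2)
  linarith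

/-! ### Laws with few atoms -/

/-- The law with atoms at `x`, `y`, `z`, `0` and cumulative weights `p ≤ q ≤ r ≤ 1`. -/
noncomputable def fourPoint (p q r x y z : ℝ) : Measure ℝ :=
  ENNReal.ofReal p • Measure.dirac x + ENNReal.ofReal (q - p) • Measure.dirac y +
    ENNReal.ofReal (r - q) • Measure.dirac z + ENNReal.ofReal (1 - r) • Measure.dirac 0

section fourPoint

variable {p q r x y z : ℝ}

theorem isProbabilityMeasure_fourPoint (hp : 0 ≤ p) (hpq : p ≤ q) (hqr : q ≤ r) (hr : r ≤ 1) :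
    IsProbabilityMeasure (fourPoint p q r x y z) := ⟨by
  simp only [fourPoint, Measure.add_apply, Measure.smul_apply, measure_univ, smul_eq_mul, mul_one]
  rw [← ENNReal.ofReal_add hp (by linarith), ← ENNReal.ofReal_add (by linarith) (by linarith),
    ← ENNReal.ofReal_add (by linarith) (by linarith)]
  simp⟩

theorem integral_fourPoint (hp : 0 ≤ p) (hpq : p ≤ q) (hqr : q ≤ r) (hr : r ≤ 1) (f : ℝ → ℝ) :
    ∫ u, f u ∂(fourPoint p q r x y z) = p * f x + (q - p) * f y + (r - q) * f z + (1 - r) * f 0 := by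
  have hi : ∀ (c a : ℝ), Integrable f (ENNReal.ofReal c • Measure.dirac a) := fun c a =>
    (integrable_dirac (by simp)).smul_measure ENNReal.ofReal_ne_top
  rw [fourPoint, integral_add_measure (((hi _ _).add_measure (hi _ _)).add_measure (hi _ _))
    (hi _ _), integral_add_measure ((hi _ _).add_measure (hi _ _)) (hi _ _),
    integral_add_measure (hi _ _) (hi _ _)]
  simp only [integral_smul_measure, integral_dirac, smul_eq_mul]
  rw [ENNReal.toReal_ofReal hp, ENNReal.toReal_ofReal (by linarith),
    ENNReal.toReal_ofReal (by linarith), ENNReal.toReal_ofReal (by linarith)]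

theorem cdf_eq_integral (μ : Measure ℝ) [IsProbabilityMeasure μ] (u : ℝ) :
    cdf μ u = ∫ v, (if v ≤ u then 1 else 0 : ℝ) ∂μ := by
  rw [cdf_eq_real, ← integral_indicator_one measurableSet_Iic]
  rfl

theorem fourPoint_mem_compactLaws (hp : 0 ≤ p) (hpq : p ≤ q) (hqr : q ≤ r) (hr : r ≤ 1) :
    fourPoint p q r x y z ∈ compactLaws := by
  have hK : IsCompact ({x, y, z, 0} : Set ℝ) := (toFinite _).isCompact
  refine ⟨isProbabilityMeasure_fourPoint hp hpq hqr hr, _, hK, ?_⟩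
  simp [fourPoint, Measure.dirac_apply' _ hK.isClosed.measurableSet.compl]

end fourPoint

/-- The signed Choquet integral of a law whose survival function is `q` on `[0, s)`, `p` on
`[s, t)` and `0` beyond. -/
theorem signedChoquet_of_two_levels {h : ℝ → ℝ} (hh : IsDistortion h) {μ : Measure ℝ} {p q s t : ℝ}
    (hs : 0 ≤ s) (hst : s ≤ t)
    (hμ : ∀ u, cdf μ u = if u < 0 then 0 else if u < s then 1 - q else if u < t then 1 - p else 1) :
    signedChoquet h μ = s * h q + (t - s) * h p := by
  have hi := hh.bv.intervalIntegrable_comp_cdf (μ := μ)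
  rw [signedChoquet_eq_of_cdf hh (hs.trans hst)
      (fun u hu => by rw [hμ, if_pos (by linarith)])
      (fun u hu => by
        rw [hμ, if_neg (by linarith), if_neg (by linarith), if_neg (by linarith)]),
    ← intervalIntegral.integral_add_adjacent_intervals (hi (-t) 0) (hi 0 t),
    ← intervalIntegral.integral_add_adjacent_intervals (hi 0 s) (hi s t)]
  have key : ∀ a b c : ℝ, a ≤ b → (∀ u ∈ Ioo a b, cdf μ u = 1 - c) →
      ∫ u in a..b, h (1 - cdf μ u) = (b - a) * h c := by
    intro a b c hab hc
    rw [← smul_eq_mul, ← intervalIntegral.integral_const, intervalIntegral.integral_of_le hab,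
      intervalIntegral.integral_of_le hab, integral_Ioc_eq_integral_Ioo,
      integral_Ioc_eq_integral_Ioo]
    refine setIntegral_congr_fun measurableSet_Ioo fun u hu => ?_
    simp only [hc u hu, sub_sub_cancel]
  rw [key (-t) 0 1 (by linarith) fun u hu => by rw [hμ, if_pos hu.2, sub_self],
    key 0 s q hs fun u hu => by rw [hμ, if_neg (not_lt.2 hu.1.le), if_pos hu.2],
    key s t p hst fun u hu => by
      rw [hμ, if_neg (not_lt.2 (hs.trans hu.1.le)), if_neg (not_lt.2 hu.1.le), if_pos hu.2]]
  ring

/-- The law with survival function `q` on `[0, s)`, `p` on `[s, t)` and `0` beyond. -/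
noncomputable def twoLevel (p q s t : ℝ) : Measure ℝ := fourPoint p q q t s 0

section twoLevel

variable {p q s t : ℝ}

theorem isProbabilityMeasure_twoLevel (hp : 0 ≤ p) (hpq : p ≤ q) (hq : q ≤ 1) :
    IsProbabilityMeasure (twoLevel p q s t) :=
  isProbabilityMeasure_fourPoint hp hpq le_rfl hq

theorem twoLevel_mem_compactLaws (hp : 0 ≤ p) (hpq : p ≤ q) (hq : q ≤ 1) :
    twoLevel p q s t ∈ compactLaws :=
  fourPoint_mem_compactLaws hp hpq le_rfl hq

theorem cdf_twoLevel (hp : 0 ≤ p) (hpq : p ≤ q) (hq : q ≤ 1) (hs : 0 ≤ s) (hst : s ≤ t) (u : ℝ) :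
    cdf (twoLevel p q s t) u =
      if u < 0 then 0 else if u < s then 1 - q else if u < t then 1 - p else 1 := by
  have := isProbabilityMeasure_twoLevel (s := s) (t := t) hp hpq hq
  rw [cdf_eq_integral, twoLevel, integral_fourPoint hp hpq le_rfl hq]
  split_ifs <;> linarith

theorem signedChoquet_twoLevel {h : ℝ → ℝ} (hh : IsDistortion h) (hp : 0 ≤ p) (hpq : p ≤ q)
    (hq : q ≤ 1) (hs : 0 ≤ s) (hst : s ≤ t) :
    signedChoquet h (twoLevel p q s t) = s * h q + (t - s) * h p :=
  signedChoquet_of_two_levels hh hs hst (cdf_twoLevel hp hpq hq hs hst)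

end twoLevel

/-! ### Each functional property forces convexity -/

theorem IsDistortion.convexOn_of_midpoint {h : ℝ → ℝ} (hh : IsDistortion h)
    (hmid : ∀ a ∈ Icc (0 : ℝ) 1, ∀ c ∈ Icc (0 : ℝ) 1, a ≤ c →
      2 * h ((a + c) / 2) ≤ h a + h c) : ConvexOn ℝ (Icc 0 1) h := by
  obtain ⟨B, hB⟩ := hh.bv.exists_abs_le
  refine _root_.convexOn_of_midpoint (convex_Icc 0 1) (fun x hx y hy => ?_)
    fun x hx => (le_abs_self _).trans (hB x hx)
  rcases le_total x y with hxy | hxy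
  · exact hmid x hx y hy hxy
  · rw [add_comm x y, add_comm (h x)]
    exact hmid y hy x hx hxy

theorem convexOn_of_concaveOrderMonotone {h : ℝ → ℝ} (hh : IsDistortion h)
    (hm : ConcaveOrderMonotone (signedChoquet h)) : ConvexOn ℝ (Icc 0 1) h := by
  refine hh.convexOn_of_midpoint fun a ha c hc hac => ?_
  have hb0 : 0 ≤ (a + c) / 2 := by linarith [ha.1, hc.1]
  have hb1 : (a + c) / 2 ≤ 1 := by linarith [ha.2, hc.2]
  have hhalf : (0 : ℝ) ≤ 1 / 2 := by norm_num
  -- The first law is a mean-preserving spread of the second: the mass `c - a` at `1 / 2` is divided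
  -- equally between `0` and `1`.
  have key := hm (twoLevel ((a + c) / 2) ((a + c) / 2) (1 / 2) 1)
    (twoLevel_mem_compactLaws hb0 le_rfl hb1) (twoLevel a c (1 / 2) 1)
    (twoLevel_mem_compactLaws ha.1 hac hc.2) ?_
  · rw [signedChoquet_twoLevel hh hb0 le_rfl hb1 hhalf (by norm_num),
      signedChoquet_twoLevel hh ha.1 hac hc.2 hhalf (by norm_num)] at key
    linarith
  · intro f hf
    rw [twoLevel, twoLevel, integral_fourPoint hb0 le_rfl le_rfl hb1,
      integral_fourPoint ha.1 hac le_rfl hc.2]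
    have := hf.2 (mem_univ 0) (mem_univ 1) hhalf hhalf (by norm_num)
    simp only [smul_eq_mul, mul_zero, mul_one, zero_add] at this
    nlinarith

theorem convexOn_of_mQuasiConvex {h : ℝ → ℝ} (hh : IsDistortion h)
    (hcase : ContinuousOn h (Icc 0 1) ∨ StrictMonoOn h (Icc 0 1) ∨ StrictAntiOn h (Icc 0 1))
    (hm : MQuasiConvex (signedChoquet h)) : ConvexOn ℝ (Icc 0 1) h := by
  obtain ⟨B, hB⟩ := hh.bv.exists_abs_le
  refine hh.convexOn_of_midpoint fun x hx y hy _ =>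
    midpoint_convex_of_quasiconvex hB hcase ?_ x hx y hy
  intro m hm01 a ha c hc a' ha' c' hc' α β hα hβ
  have hhalf : (1 / 2 : ℝ) ∈ Icc (0 : ℝ) 1 := by norm_num
  have h1 : a ≤ a' := ha.2.trans ha'.1
  have h2 : c ≤ c' := hc.2.trans hc'.1
  have hst : β ≤ α + β := by linarith
  have := isProbabilityMeasure_twoLevel (s := β) (t := α + β) ha.1 h1 ha'.2
  have := isProbabilityMeasure_twoLevel (s := β) (t := α + β) hc.1 h2 hc'.2
  -- Step lengths `β` and `α` become the weights of the upper and lower levels, and an equal mixture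
  -- averages corresponding levels.
  have key := hm (twoLevel a a' β (α + β)) (twoLevel_mem_compactLaws ha.1 h1 ha'.2)
    (twoLevel c c' β (α + β)) (twoLevel_mem_compactLaws hc.1 h2 hc'.2) (1 / 2) hhalf
  rw [signedChoquet_twoLevel hh ha.1 h1 ha'.2 hβ hst, signedChoquet_twoLevel hh hc.1 h2 hc'.2 hβ hst,
    signedChoquet_of_two_levels hh (p := (a + c) / 2) (q := (a' + c') / 2) hβ hst] at key
  · simpa only [add_sub_cancel_right, add_comm] using key
  · intro u
    rw [cdf_mixture _ _ hhalf, cdf_twoLevel ha.1 h1 ha'.2 hβ hst, cdf_twoLevel hc.1 h2 hc'.2 hβ hst]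
    split_ifs <;> ring

theorem convexOn_of_oQuasiConcave {Ω : Type*} [MeasurableSpace Ω] {P : Measure Ω}
    [IsProbabilityMeasure P] (hrich : ∀ μ ∈ compactLaws, ∃ X : Ω → ℝ, Measurable X ∧ P.map X = μ)
    {h : ℝ → ℝ} (hh : IsDistortion h) (hq : OQuasiConcave P (signedChoquetRV P h)) :
    ConvexOn ℝ (Icc 0 1) h := by
  refine hh.convexOn_of_midpoint fun a ha c hc hac => ?_
  have hb1 : a ≤ (a + c) / 2 := by linarith
  have hb2 : (a + c) / 2 ≤ c := by linarith
  have hhalf : (1 / 2 : ℝ) ∈ Icc (0 : ℝ) 1 := by norm_num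
  -- `W` encodes two events, `{2, 3}` and `{1, 3}`, each of probability `(a + c) / 2`, with
  -- intersection of probability `a` and union of probability `c`. Half the sum of their indicators
  -- has levels `c` and `a`.
  obtain ⟨W, hW, hWlaw⟩ := hrich (fourPoint a ((a + c) / 2) c 3 2 1)
    (fourPoint_mem_compactLaws ha.1 hb1 hb2 hc.2)
  have hcdf : ∀ f : ℝ → ℝ, Measurable f → ∀ u, cdf (P.map (f ∘ W)) u =
      a * (if f 3 ≤ u then 1 else 0) + ((a + c) / 2 - a) * (if f 2 ≤ u then 1 else 0) +
        (c - (a + c) / 2) * (if f 1 ≤ u then 1 else 0) + (1 - c) * (if f 0 ≤ u then 1 else 0) := by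
    intro f hf u
    have := Measure.isProbabilityMeasure_map (μ := P) (hf.comp hW).aemeasurable
    have hind : Measurable fun v : ℝ => (if v ≤ u then 1 else 0 : ℝ) :=
      Measurable.ite measurableSet_Iic measurable_const measurable_const
    rw [cdf_eq_integral, ← Measure.map_map hf hW, hWlaw,
      integral_map hf.aemeasurable hind.aestronglyMeasurable,
      integral_fourPoint ha.1 hb1 hb2 hc.2]
  set f : ℝ → ℝ := ({2, 3} : Set ℝ).indicator 1 with hf
  set g : ℝ → ℝ := ({1, 3} : Set ℝ).indicator 1 with hg
  have fm : Measurable f := measurable_one.indicator (toFinite _).measurableSet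
  have gm : Measurable g := measurable_one.indicator (toFinite _).measurableSet
  have hbd : ∀ A : Set ℝ, Measurable (A.indicator (1 : ℝ → ℝ)) →
      A.indicator (1 : ℝ → ℝ) ∘ W ∈ boundedRV P := by
    intro A hA
    refine ⟨hA.comp hW, 1, Filter.Eventually.of_forall fun ω => ?_⟩
    by_cases hω : W ω ∈ A <;> simp [hω]
  have f3 : f 3 = 1 := by simp [hf]
  have f2 : f 2 = 1 := by simp [hf]
  have f1 : f 1 = 0 := by simp [hf]
  have f0 : f 0 = 0 := by simp [hf]
  have g3 : g 3 = 1 := by simp [hg]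
  have g2 : g 2 = 0 := by simp [hg]
  have g1 : g 1 = 1 := by simp [hg]
  have g0 : g 0 = 0 := by simp [hg]
  have key := hq (f ∘ W) (hbd _ fm) (g ∘ W) (hbd _ gm) (1 / 2) hhalf
  have e : (1 / 2 : ℝ) • (f ∘ W) + (1 - 1 / 2 : ℝ) • (g ∘ W)
      = (fun v => 1 / 2 * f v + (1 - 1 / 2) * g v) ∘ W := rfl
  rw [e, signedChoquetRV, signedChoquetRV, signedChoquetRV,
    signedChoquet_of_two_levels hh (p := (a + c) / 2) (q := (a + c) / 2) (s := 1) (t := 1)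
      (μ := P.map (f ∘ W)) (by norm_num) le_rfl,
    signedChoquet_of_two_levels hh (p := (a + c) / 2) (q := (a + c) / 2) (s := 1) (t := 1)
      (μ := P.map (g ∘ W)) (by norm_num) le_rfl,
    signedChoquet_of_two_levels hh (p := a) (q := c) (s := 1 / 2) (t := 1) (by norm_num)
      (by norm_num), min_self] at key
  · linarith
  · intro u
    rw [hcdf (fun v => 1 / 2 * f v + (1 - 1 / 2) * g v) ((fm.const_mul _).add (gm.const_mul _))]
    simp only [f0, f1, f2, f3, g0, g1, g2, g3]
    norm_num
    split_ifs <;> linarith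
  · intro u
    rw [hcdf _ gm]
    simp only [g0, g1, g2, g3]
    split_ifs <;> linarith
  · intro u
    rw [hcdf _ fm]
    simp only [f0, f1, f2, f3]
    split_ifs <;> linarith

theorem mainTheorem2 {Ω : Type*} [MeasurableSpace Ω] (P : Measure Ω) [IsProbabilityMeasure P]
    (hrich : ∀ μ ∈ compactLaws, ∃ X : Ω → ℝ, Measurable X ∧ P.map X = μ)
    (h : ℝ → ℝ) (hh : IsDistortion h)
    (hcase : ContinuousOn h (Icc 0 1) ∨ StrictMonoOn h (Icc 0 1) ∨ StrictAntiOn h (Icc 0 1)) :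
    List.TFAE
      [ConvexOn ℝ (Icc 0 1) h,
       ConcaveOrderMonotone (signedChoquet h),
       OSuperadditive P (signedChoquetRV P h),
       OConcave P (signedChoquetRV P h),
       OQuasiConcave P (signedChoquetRV P h),
       MConvex (signedChoquet h),
       MQuasiConvex (signedChoquet h)] := by
  tfae_have 1 → 2 := concaveOrderMonotone_of_convexOn hh
  tfae_have 2 → 1 := convexOn_of_concaveOrderMonotone hh
  tfae_have 1 → 3 := oSuperadditive_of_convexOn hh
  tfae_have 3 → 4 := OSuperadditive.oConcave hh
  tfae_have 4 → 5 := OConcave.oQuasiConcave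
  tfae_have 5 → 1 := convexOn_of_oQuasiConcave hrich hh
  tfae_have 1 → 6 := mConvex_of_convexOn hh
  tfae_have 6 → 7 := MConvex.mQuasiConvex
  tfae_have 7 → 1 := convexOn_of_mQuasiConvex hh hcase
  tfae_finish
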